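/- Conventions. In a simplicial set $X$ with face maps $d_i$ and degeneracy maps $s_i$, a $k$-cycle is a tuple $(c_0,\dots,c_{k+1})$ of $k$-simplices with $d_ic_j=d_{j-1}c_i$ for all $i<j$ (no condition if $k=0$). Two $k$-simplices $x,y$ with the same faces are homotopic, $x\sim y$, if some $(k+1)$-simplex has boundary $(s_{k-1}d_0x,\dots,s_{k-1}d_{k-1}x,x,y)$. $X$ is minimal if $x\sim y$ implies $x=y$. For a pointed Kan complex $(X,\star)$, $\pi_k(X,\star)$ is the set of $k$-simplices all of whose faces are $\star$, modulo $\sim$; for $k\ge1$ the product is given by $[x][y]=[z]$ if some $(k+1)$-simplex has boundary $(\star,\dots,\star,y,z,x)$. For an abelian group $A$ and $n\ge 1$, a pointed Kan complex is an Eilenberg–Mac Lane space for $(A,n)$ if its $\pi_n$ is isomorphic to $A$ as a group and $\pi_k$ is trivial for all $k\neq n$ (including $k=0$). Theorem. Let $A$ be an abelian group and $n\ge1$. Let $S$ be the simplicial $(n+1)$-skeleton (simplicial set truncated above dimension $n+1$) with $S_k=\{\star\}$ for $k<n$, $S_n=A$ (the degenerate $n$-simplex being $0$) and $$S_{n+1}=\{(a_0,\dots,a_{n+1})\in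 A^{n+2}\mid a_0-a_1+\dots\pm a_{n+1}=0\},$$ with $d_i(a_0,\dots,a_{n+1})=a_i$ and $s_i a=(0,\dots,0,a,a,0,\dots,0)$ ($a$ in places $i,i+1$). Let $H(A,n)$ be its completion, i.e. the value at $S$ of the right adjoint of the restriction functor from simplicial sets to $(n+1)$-skeletons. Then: 1. $H(A,n)$ agrees with $S$ in dimensions $\le n+1$, and for every $k\ge n+1$ each $k$-cycle of $H(A,n)$ is the boundary of exactly one $(k+1)$-simplex. 2. $H(A,n)$ is a minimal Kan complex, and with its unique base point it is an Eilenberg–Mac Lane space for $(A,n)$. 3. It is unique up to isomorphism: every minimal pointed Kan complex that is an Eilenberg–Mac Lane space for $(A,n)$ is isomorphic to $H(A,n)$ as a pointed simplicial set. -/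

import Mathlib

open CategoryTheory Simplicial Opposite

universe u

namespace EilenbergMacLane

section Minimal

variable {X : SSet.{u}}

/-- The boundaries of two `n`-simplices agree: `∂x = ∂y`. (A `0`-simplex has no faces.) -/
def SameBoundary {n : ℕ} (x y : X _⦋n⦌) : Prop :=
  match n, x, y with
  | 0, _, _ => True
  | _ + 1, x, y => ∀ i, X.δ i x = X.δ i y

/-- Two `n`-simplices with the same boundary are homotopic if
`(s_{n-1} d_0 x, …, s_{n-1} d_{n-1} x, x, y)` is the boundary of an `(n+1)`-simplex `h`.
The entry `s_{n-1} d_i x`, for `i < n`, is written here as `d_i s_n x`, to which it is equal by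
the simplicial identities. -/
def Homotopic {n : ℕ} (x y : X _⦋n⦌) : Prop :=
  SameBoundary x y ∧ ∃ h : X _⦋n + 1⦌,
    (∀ i : Fin n, X.δ i.castSucc.castSucc h = X.δ i.castSucc.castSucc (X.σ (Fin.last n) x)) ∧
    X.δ (Fin.last n).castSucc h = x ∧
    X.δ (Fin.last (n + 1)) h = y

variable (X) in
/-- Minimality: homotopic simplices (with the same boundary) are equal. -/
def IsMinimal : Prop :=
  ∀ (n : ℕ) (x y : X _⦋n⦌), Homotopic x y → x = y

end Minimal

section HomotopyGroups

/-- The set `π_n(X, x)`: the `n`-simplices of `X` all of whose faces are the base point, up to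
the relation `f ∼ g` if `(⋆, …, ⋆, f, g)` is the boundary of an `(n+1)`-simplex. (This
is an equivalence relation if `X` is a Kan complex.) -/
def Pi (n : ℕ) (X : SSet.{u}) (x : X _⦋0⦌) : Type u :=
  Quot fun f g : X.PtSimplex n x ↦ Nonempty (SSet.PtSimplex.RelStruct f g (Fin.last n))

/-- `fg` represents the composition `[f][g]` in `π_n(X, x)`, `n ≥ 1`:
`(⋆, …, ⋆, g, fg, f)` is the boundary of an `(n+1)`-simplex. -/
def IsComposition {n : ℕ} {X : SSet.{u}} {x : X _⦋0⦌} (f g fg : X.PtSimplex n x) : Prop :=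
  ∃ i : Fin n, (i : ℕ) + 1 = n ∧ Nonempty (SSet.PtSimplex.MulStruct f g fg i)

/-- `(X, x)` is an Eilenberg-Mac Lane space in dimension `n ≥ 1` for the abelian group `A`: a Kan
complex with `π_k(X, x)` trivial for `k ≠ n`, and `π_n(X, x) ≅ A` as groups. -/
structure IsEilenbergMacLaneSpace (A : Type u) [AddCommGroup A] (n : ℕ)
    (X : SSet.{u}) (x : X _⦋0⦌) : Prop where
  kan : SSet.KanComplex X
  trivial : ∀ k : ℕ, k ≠ n → Nonempty (Unique (Pi k X x))
  iso : ∃ φ : Pi n X x ≃ A, ∀ f g fg : X.PtSimplex n x, IsComposition f g fg →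
    φ (Quot.mk _ fg) = φ (Quot.mk _ f) + φ (Quot.mk _ g)

end HomotopyGroups

section Completion

/-- A `k`-cycle: a tuple `(c_0, …, c_{k+1})` of `k`-simplices with `d_i c_j = d_{j-1} c_i` for
`i < j`. (For `k = 0` there is no condition.) -/
def IsCycle {X : SSet.{u}} {k : ℕ} (c : Fin (k + 2) → X _⦋k⦌) : Prop :=
  match k, c with
  | 0, _ => True
  | k + 1, c => ∀ i j : Fin (k + 2), i ≤ j → X.δ i (c j.succ) = X.δ j (c i.castSucc)

/-- `K` is the canonical completion of the `N`-skeleton `S` (a simplicial set truncated above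
dimension `N`): it extends `S`, and for `k ≥ N` every `k`-cycle is filled by exactly one
`(k+1)`-simplex. -/
structure IsCanonicalCompletion {N : ℕ} (S : SSet.Truncated.{u} N) (K : SSet.{u}) : Prop where
  extends_skeleton : Nonempty ((SSet.truncation N).obj K ≅ S)
  fill : ∀ k : ℕ, N ≤ k → ∀ c : Fin (k + 2) → K _⦋k⦌, IsCycle c →
    ∃! y : K _⦋k + 1⦌, ∀ i, K.δ i y = c i

end Completion

section Model

variable (A : Type u) [AddCommGroup A] (n : ℕ)

/-- The functions `f` assigning an element of `A` to each monotone map `[n] → [k]`, with value `0`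
on the maps which are not injective, and such that for every monotone map `g : [n+1] → [k]`, the
alternating sum of the values at the faces of `g` vanishes.
For `k < n` there are no injections `[n] → [k]`, so this is a point. For `k = n`, the identity is
the only injection, so this is `A`. For `k = n + 1`, the injections are the `n + 2` face inclusions,
so this is the set of tuples `(a_0, …, a_{n+1})` with `a_0 - a_1 + … ± a_{n+1} = 0`. -/
def Labelling (k : SimplexCategory) : Type u :=
  { f : (⦋n⦌ ⟶ k) → A //
    (∀ e : ⦋n⦌ ⟶ k, ¬ Function.Injective e.toOrderHom → f e = 0) ∧
    ∀ g : ⦋n + 1⦌ ⟶ k,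
      ∑ i : Fin (n + 2), (-1 : ℤ) ^ (i : ℕ) • f (SimplexCategory.δ i ≫ g) = 0 }

variable {A n} in
/-- Labellings are pulled back by composition. -/
def Labelling.pullback {k l : SimplexCategory} (θ : l ⟶ k) (f : Labelling A n k) :
    Labelling A n l :=
  ⟨fun e ↦ f.1 (e ≫ θ), by
    refine ⟨fun e he ↦ f.2.1 _ fun h ↦ he ?_, fun g ↦ ?_⟩
    · intro a b hab
      exact h (by simp [hab])
    · simpa only [Category.assoc] using f.2.2 (g ≫ θ)⟩

/-- The `(n+1)`-skeleton with a single point in the dimensions below `n`, with `A` in dimension `n`,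
and with the tuples of vanishing alternating sum in dimension `n + 1`. -/
def skeleton : SSet.Truncated.{u} (n + 1) where
  obj k := Labelling A n k.unop.obj
  map θ := ↾(Labelling.pullback θ.unop.hom)
  map_id k := by
    ext f
    refine Subtype.ext (funext fun e ↦ ?_)
    exact congrArg f.1 (Category.comp_id e)
  map_comp θ η := by
    ext f
    refine Subtype.ext (funext fun e ↦ ?_)
    exact congrArg f.1 (Category.assoc e _ _).symm

/-- The simplicial set `H(A, n)`: the completion of the skeleton above, i.e. its image under
the right adjoint of the restriction functor. -/
noncomputable def H : SSet.{u} := (SSet.Truncated.cosk (n + 1)).obj (skeleton A n)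

/-- `X` has a single simplex in each dimension below `n`, its `n`-simplices are the elements of `A`,
the degenerate one being `0`, and its `(n+1)`-simplices are the tuples
`(a_0, …, a_{n+1})` of elements of `A` with `a_0 - a_1 + … ± a_{n+1} = 0`, with `d_i` picking the
`i`-th entry and `s_i a = (0, …, 0, a, a, 0, …, 0)`, where `a` is at the places `i` and `i+1`. -/
def HasStandardLowSimplices (X : SSet.{u}) : Prop :=
  (∀ k : ℕ, k < n → Nonempty (Unique (X _⦋k⦌))) ∧
  ∃ label : X _⦋n⦌ ≃ A,
    (∀ x ∈ X.degenerate n, label x = 0) ∧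
    (∀ y : X _⦋n + 1⦌, ∑ i : Fin (n + 2), (-1 : ℤ) ^ (i : ℕ) • label (X.δ i y) = 0) ∧
    (∀ a : Fin (n + 2) → A, ∑ i : Fin (n + 2), (-1 : ℤ) ^ (i : ℕ) • a i = 0 →
      ∃! y : X _⦋n + 1⦌, ∀ i, label (X.δ i y) = a i) ∧
    (∀ (x : X _⦋n⦌) (i : Fin (n + 1)) (j : Fin (n + 2)),
      label (X.δ j (X.σ i x)) = if j = i.castSucc ∨ j = i.succ then label x else 0)

end Model

end EilenbergMacLane

/-! The simplicial set `H A n` is identified with `cocycleSet A n`, whose k-simplices are the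
normalized n-cocycles on Δ^k. The cocycle condition only involves simplices of dimension at most n +
1, so this set is coskeletal. It is a simplicial abelian group, hence Kan (Moore). A cocycle on a
simplex of dimension above n is determined by its faces, and compatible faces glue in dimensions
above n + 1; minimality in dimension n and the group law of π_n come from the vanishing of one
alternating sum.

For uniqueness, let X be minimal with the right homotopy groups. It has one simplex in each
dimension below n, and its n-simplices are labelled by π_n ≅ A. Horn filling and minimality make the
penultimate entry of the boundary of an (n+1)-simplex a function of the others. The product of π_n
and the degenerate simplices force this function to be the one given by the alternating sum
(`GroupLabel.isBoundary_iff`). The labels thus form a normalized cocycle on X, that is, a morphism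
to `cocycleSet A n` (`exists_hom`).

Its bijectivity goes up by induction on the dimension. Surjectivity is horn filling. For
injectivity, a simplex with label 0 is pointed, so it is unique because π_k is trivial and X is
minimal; uniqueness for any other label is carried over from label 0 along a chain of cocycles
(`exists_chain`, `label_injective_succ`). -/

namespace EilenbergMacLane

/-! ### Values of labellings -/

namespace Labelling

variable {A : Type u} [AddCommGroup A] {n : ℕ} {k l : SimplexCategory}

/-- The value of a labelling at a monotone map. -/
def val (f : Labelling A n k) (e : ⦋n⦌ ⟶ k) : A := f.1 e

lemma ext {f g : Labelling A n k} (h : ∀ e, f.val e = g.val e) : f = g :=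
  Subtype.ext (funext h)

lemma val_of_not_injective (f : Labelling A n k) (e : ⦋n⦌ ⟶ k)
    (he : ¬ Function.Injective e.toOrderHom) : f.val e = 0 := f.2.1 e he

lemma sum_val (f : Labelling A n k) (g : ⦋n + 1⦌ ⟶ k) :
    ∑ i : Fin (n + 2), (-1 : ℤ) ^ (i : ℕ) • f.val (SimplexCategory.δ i ≫ g) = 0 := f.2.2 g

lemma val_pullback (θ : l ⟶ k) (f : Labelling A n k) (e : ⦋n⦌ ⟶ l) :
    (f.pullback θ).val e = f.val (e ≫ θ) := rfl

lemma val_pullback_id (θ : ⦋n⦌ ⟶ k) (f : Labelling A n k) :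
    (f.pullback θ).val (𝟙 _) = f.val θ :=
  congrArg f.1 (Category.id_comp θ)

/-- Build a labelling from its values. -/
def mk (f : (⦋n⦌ ⟶ k) → A) (h₁ : ∀ e : ⦋n⦌ ⟶ k, ¬ Function.Injective e.toOrderHom → f e = 0)
    (h₂ : ∀ g : ⦋n + 1⦌ ⟶ k,
      ∑ i : Fin (n + 2), (-1 : ℤ) ^ (i : ℕ) • f (SimplexCategory.δ i ≫ g) = 0) :
    Labelling A n k := ⟨f, h₁, h₂⟩

lemma val_mk (f : (⦋n⦌ ⟶ k) → A) (h₁ h₂) (e : ⦋n⦌ ⟶ k) :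
    (mk f h₁ h₂).val e = f e := rfl

end Labelling

/-! ### Normalized cocycles and coskeletality -/

section ClassifyingSet

variable (A : Type u) [AddCommGroup A] (n : ℕ)

/-- The simplicial set of normalized `n`-cocycles on the standard simplices. -/
def cocycleSet : SSet.{u} where
  obj k := Labelling A n k.unop
  map θ := ↾(Labelling.pullback θ.unop)
  map_id k := by
    ext f
    refine Subtype.ext (funext fun e ↦ ?_)
    exact congrArg f.1 (Category.comp_id e)
  map_comp θ η := by
    ext f
    refine Subtype.ext (funext fun e ↦ ?_)
    exact congrArg f.1 (Category.assoc e _ _).symm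

variable {A n}

open CategoryTheory.Functor StructuredArrow

/-- A map `⦋m⦌ ⟶ k` with `m ≤ n + 1`, as an object of the index category of the pointwise right
Kan extension. -/
abbrev strArrow {k : SimplexCategory} {m : ℕ} (hm : m ≤ n + 1) (e : ⦋m⦌ ⟶ k) :
    StructuredArrow (op k) (SimplexCategory.Truncated.inclusion (n + 1)).op :=
  StructuredArrow.mk (Y := op (⟨⦋m⦌, hm⟩ : SimplexCategory.Truncated (n + 1)))
    (show op k ⟶ op ⦋m⦌ from e.op)

/-- Precomposition as a morphism of the index category. -/
abbrev strArrowHom {k : SimplexCategory} {m m' : ℕ} (hm : m ≤ n + 1) (hm' : m' ≤ n + 1)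
    (e : ⦋m⦌ ⟶ k) (θ : ⦋m'⦌ ⟶ ⦋m⦌) : strArrow (n := n) hm e ⟶ strArrow hm' (θ ≫ e) :=
  StructuredArrow.homMk (SimplexCategory.Truncated.Hom.tr θ hm' hm).op (by rfl)

/-- Cones over the diagram of the pointwise right Kan extension. -/
abbrev CoskCone (A : Type u) [AddCommGroup A] (n : ℕ) (k : SimplexCategory) :=
  Limits.Cone (StructuredArrow.proj (op k) (SimplexCategory.Truncated.inclusion (n + 1)).op ⋙
    (SimplexCategory.Truncated.inclusion (n + 1)).op ⋙ cocycleSet A n)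

/-- The component of a cone at a map `⦋m⦌ ⟶ k`. -/
def coneValue {k : SimplexCategory} (s : CoskCone A n k) (p : s.pt) {m : ℕ} (hm : m ≤ n + 1)
    (e : ⦋m⦌ ⟶ k) : Labelling A n ⦋m⦌ :=
  s.π.app (strArrow hm e) p

lemma coneValue_comp {k : SimplexCategory} (s : CoskCone A n k) (p : s.pt)
    {m m' : ℕ} (hm : m ≤ n + 1) (hm' : m' ≤ n + 1) (e : ⦋m⦌ ⟶ k) (θ : ⦋m'⦌ ⟶ ⦋m⦌) :
    coneValue s p hm' (θ ≫ e) = (coneValue s p hm e).pullback θ :=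
  (ConcreteCategory.congr_hom (s.w (strArrowHom hm hm' e θ)) p).symm

/-- The labelling obtained from a cone. -/
def coneLift {k : SimplexCategory} (s : CoskCone A n k) (p : s.pt) : Labelling A n k :=
  .mk (fun e ↦ (coneValue s p (Nat.le_succ n) e).val (𝟙 _))
    (by
      intro e he
      cases n with
      | zero => exact absurd (fun a b _ ↦ Subsingleton.elim (α := Fin 1) a b) he
      | succ n =>
        obtain ⟨i, θ, rfl⟩ := SimplexCategory.eq_σ_comp_of_not_injective e he
        -- The component at a degenerate map is pulled back along a degeneracy from one dimension
        -- lower, so its value at the identity is the value at a non-injective map.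
        rw [coneValue_comp s p (Nat.le_succ_of_le (Nat.le_succ n))]
        refine (coneValue s p _ θ).val_of_not_injective _ fun h ↦ ?_
        have := Fintype.card_le_of_injective _ h
        simp at this)
    (by
      intro g
      rw [← (coneValue s p le_rfl g).sum_val (𝟙 _)]
      refine Finset.sum_congr rfl fun i _ ↦ ?_
      rw [coneValue_comp s p le_rfl, Labelling.val_pullback, Category.id_comp, Category.comp_id])

/-- `cocycleSet A n` is the pointwise right Kan extension of its restriction to dimensions
at most `n + 1`. -/
noncomputable def isPointwiseRightKanExtension :
    (SSet.Truncated.rightExtensionInclusion (cocycleSet A n)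
      (n + 1)).IsPointwiseRightKanExtension := fun k ↦
  { lift s := ↾fun p ↦ coneLift (k := k.unop) s p
    fac s j := by
      ext p
      obtain ⟨⟨m, hm⟩, ⟨f : _ ⟶ _⟩, rfl⟩ := j.mk_surjective
      obtain ⟨m, rfl⟩ : ∃ j, ⦋j⦌ = m := ⟨_, m.mk_len⟩
      refine Labelling.ext fun e ↦ ?_
      have h := coneValue_comp (k := k.unop) s p hm (Nat.le_succ n) f e
      have h' := congrArg (fun x ↦ x.val (𝟙 _)) h
      exact h'.trans (Labelling.val_pullback_id _ _)
    uniq s m hm := by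
      ext p
      refine Labelling.ext fun e ↦ ?_
      have h : Labelling.pullback e (m p : Labelling A n k.unop) =
          coneValue (k := k.unop) s p (Nat.le_succ n) e :=
        ConcreteCategory.congr_hom (hm (strArrow (Nat.le_succ n) e)) p
      have h' := congrArg (fun x ↦ x.val (𝟙 _)) h
      exact (Labelling.val_pullback_id _ _).symm.trans h' }

instance : SimplicialObject.IsCoskeletal (cocycleSet A n) (n + 1) where
  isRightKanExtension :=
    RightExtension.IsPointwiseRightKanExtension.isRightKanExtension isPointwiseRightKanExtension

-- The truncation of `cocycleSet A n` is `skeleton A n` by definition, so coskeletality gives the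
-- isomorphism.
variable (A n) in
noncomputable def isoCocycleSet : H A n ≅ cocycleSet A n :=
  ((cocycleSet A n).isoCoskOfIsCoskeletal (n + 1)).symm

lemma nonempty_truncation_iso {X : SSet.{u}} (e : X ≅ cocycleSet A n) :
    Nonempty ((SSet.truncation (n + 1)).obj X ≅ skeleton A n) :=
  ⟨(SSet.truncation (n + 1)).mapIso e⟩

end ClassifyingSet

/-! ### Horn filling and Moore's theorem -/

section Horns

variable {X : SSet.{u}}

/-- The simplices `x j`, `j ≠ i`, have matching faces, so that they form an `i`-th horn. (The value
`x i` is irrelevant.) -/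
def HornCompatible {m : ℕ} (i : Fin (m + 2)) (x : Fin (m + 2) → X _⦋m⦌) : Prop :=
  match m, i, x with
  | 0, _, _ => True
  | m + 1, i, x => ∀ j k : Fin (m + 2), j ≤ k → j.castSucc ≠ i → k.succ ≠ i →
      X.δ j (x k.succ) = X.δ k (x j.castSucc)

lemma hornCompatible_succ_iff {m : ℕ} {i : Fin (m + 3)} {x : Fin (m + 3) → X _⦋m + 1⦌} :
    HornCompatible i x ↔ ∀ j k : Fin (m + 2), j ≤ k → j.castSucc ≠ i → k.succ ≠ i →
      X.δ j (x k.succ) = X.δ k (x j.castSucc) := Iff.rfl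

lemma exists_filler [SSet.KanComplex X] {m : ℕ} {i : Fin (m + 2)} {x : Fin (m + 2) → X _⦋m⦌}
    (hx : HornCompatible i x) : ∃ w : X _⦋m + 1⦌, ∀ j, j ≠ i → X.δ j w = x j := by
  have hf : SSet.horn.IsCompatible (i := i) (fun j _ ↦ SSet.yonedaEquiv.symm (x j)) := by
    cases m with
    | zero => trivial
    | succ m =>
      intro j k hj hk hjk
      obtain ⟨j, rfl⟩ := j.eq_castSucc_of_ne_last (Fin.ne_last_of_lt hjk)
      obtain ⟨k, rfl⟩ := k.eq_succ_of_ne_zero (Fin.ne_zero_of_lt hjk)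
      rw [SSet.stdSimplex.δ_comp_yonedaEquiv_symm, SSet.stdSimplex.δ_comp_yonedaEquiv_symm,
        Fin.pred_succ, Fin.castPred_castSucc, hx j k (Fin.castSucc_lt_succ_iff.1 hjk) hj hk]
  obtain ⟨φ, hφ⟩ := hf.exists_lift_of_kanComplex
  refine ⟨SSet.yonedaEquiv φ, fun j hj ↦ ?_⟩
  rw [← SSet.stdSimplex.yonedaEquiv_δ_comp, hφ j hj, Equiv.apply_symm_apply]

lemma kanComplex_of_exists_filler
    (h : ∀ (m : ℕ) (i : Fin (m + 2)) (x : Fin (m + 2) → X _⦋m⦌), HornCompatible i x →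
      ∃ w : X _⦋m + 1⦌, ∀ j, j ≠ i → X.δ j w = x j) : SSet.KanComplex X := by
  rw [SSet.KanComplex.iff]
  intro m i f hf
  classical
  have hX : Nonempty (X _⦋m⦌) := by
    obtain ⟨j, hj⟩ := exists_ne i
    exact ⟨SSet.yonedaEquiv (f j hj)⟩
  obtain ⟨x, hx⟩ : ∃ x : Fin (m + 2) → X _⦋m⦌, ∀ j hj, x j = SSet.yonedaEquiv (f j hj) :=
    ⟨fun j ↦ if hj : j ≠ i then SSet.yonedaEquiv (f j hj) else Classical.arbitrary _,
      fun j hj ↦ dif_pos hj⟩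
  obtain ⟨w, hw⟩ := h m i x (by
      cases m with
      | zero => trivial
      | succ m =>
        intro j k hjk hj hk
        have := hf j.castSucc k.succ hj hk (Fin.castSucc_lt_succ_iff.2 hjk)
        rw [Fin.pred_succ, Fin.castPred_castSucc] at this
        rw [hx _ hj, hx _ hk, ← SSet.stdSimplex.yonedaEquiv_δ_comp,
          ← SSet.stdSimplex.yonedaEquiv_δ_comp, this])
  refine ⟨SSet.yonedaEquiv.symm w, fun j hj ↦ ?_⟩
  rw [SSet.stdSimplex.δ_comp_yonedaEquiv_symm, hw j hj, hx j hj, Equiv.symm_apply_apply]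

/-- Moore's theorem for simplicial abelian groups. -/
lemma kanComplex_of_addCommGroup [∀ k, AddCommGroup (X.obj k)]
    (hX : ∀ {k l : SimplexCategoryᵒᵖ} (θ : k ⟶ l) (x y : X.obj k),
      X.map θ (x + y) = X.map θ x + X.map θ y) : SSet.KanComplex X := by
  have δ_add {m : ℕ} (i : Fin (m + 2)) (x y : X _⦋m + 1⦌) :
    X.δ i (x + y) = X.δ i x + X.δ i y := hX _ x y
  have δ_sub {m : ℕ} (i : Fin (m + 2)) (x y : X _⦋m + 1⦌) :
      X.δ i (x - y) = X.δ i x - X.δ i y := by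
    rw [eq_sub_iff_add_eq, ← δ_add, sub_add_cancel]
  have σ_zero {m : ℕ} (i : Fin (m + 1)) : X.σ i (0 : X _⦋m⦌) = 0 := by
    simpa using! hX (SimplexCategory.σ i).op (0 : X _⦋m⦌) 0
  refine kanComplex_of_exists_filler fun m i x hx ↦ ?_
  cases m with
  | zero =>
    refine ⟨X.σ 0 (x i.rev), fun j hj ↦ ?_⟩
    obtain rfl : j = i.rev := by clear hx; clear x; revert i j; decide
    generalize i.rev = k
    obtain rfl | rfl : k = Fin.castSucc 0 ∨ k = Fin.succ 0 := by revert k; decide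
    · exact SSet.δ_comp_σ_self_apply _ _
    · exact SSet.δ_comp_σ_succ_apply _ _
  | succ m =>
    rw [hornCompatible_succ_iff] at hx
    have lower (r : ℕ) (hr : r ≤ i) :
        ∃ w : X _⦋m + 2⦌, ∀ j : Fin (m + 3), (j : ℕ) < r → X.δ j w = x j := by
      induction r with
      | zero => exact ⟨0, fun j hj ↦ by simp at hj⟩
      | succ r ih =>
        obtain ⟨w, hw⟩ := ih (by lia)
        let s : Fin (m + 2) := ⟨r, by lia⟩
        -- By compatibility the defect at face r has trivial j-th face for j < r, so its degeneracy
        -- s_r corrects face r without disturbing the lower ones.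
        refine ⟨w + X.σ s (x s.castSucc - X.δ s.castSucc w), fun j hj ↦ ?_⟩
        obtain hj | hj := Nat.lt_succ_iff_lt_or_eq.1 hj
        · obtain ⟨t, ht⟩ : ∃ t : Fin (m + 1), s = t.succ :=
            ⟨⟨r - 1, by lia⟩, by ext; simp [s]; lia⟩
          obtain ⟨j, rfl⟩ := j.eq_castSucc_of_ne_last (by rintro rfl; simp at hj; lia)
          have hjt : j ≤ t.castSucc := by
            have := congrArg Fin.val ht
            rw [Fin.le_def]; simp [s] at this hj ⊢; lia
          have hs : s.castSucc ≠ i := by intro h; have := congrArg Fin.val h; simp [s] at this; lia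
          rw [ht] at hs ⊢
          rw [δ_add, SSet.δ_comp_σ_of_le_apply hjt, δ_sub, Fin.castSucc_succ,
            hx j _ hjt (by rintro rfl; simp at hj hr; lia) hs,
            SSet.δ_comp_δ_apply hjt, hw j.castSucc hj, sub_self, σ_zero, add_zero]
        · obtain rfl : j = s.castSucc := by ext; simpa [s] using hj
          rw [δ_add, SSet.δ_comp_σ_self_apply, add_sub_cancel]
    have upper (r : ℕ) (hr : r + i ≤ m + 2) : ∃ w : X _⦋m + 2⦌,
        ∀ j : Fin (m + 3), j < i ∨ m + 2 < j + r → X.δ j w = x j := by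
      induction r with
      | zero =>
        obtain ⟨w, hw⟩ := lower i le_rfl
        exact ⟨w, fun j hj ↦ hw j (hj.resolve_right (by lia))⟩
      | succ r ih =>
        obtain ⟨w, hw⟩ := ih (by lia)
        let s : Fin (m + 2) := ⟨m + 1 - r, by lia⟩
        have hs : s.succ ≠ i := by intro h; have := congrArg Fin.val h; simp [s] at this; lia
        -- The same correction from the top downwards. It may alter faces i, …, s, but these are the
        -- omitted face and faces still to be corrected.
        refine ⟨w + X.σ s (x s.succ - X.δ s.succ w), fun j hj ↦ ?_⟩
        obtain hjs | rfl | hjs := lt_trichotomy j s.succ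
        · have hji : j < i := hj.resolve_right fun h ↦ by
            rw [Fin.lt_def] at hjs; simp [s] at hjs; lia
          obtain ⟨t, ht⟩ : ∃ t : Fin (m + 1), s = t.succ :=
            ⟨⟨m - r, by lia⟩, by ext; simp [s]; lia⟩
          obtain ⟨j, rfl⟩ := j.eq_castSucc_of_ne_last (by
            rintro rfl; exact absurd hji (Fin.le_last i).not_gt)
          have hjt : j ≤ t.castSucc := by
            have := congrArg Fin.val ht
            rw [Fin.lt_def] at hji
            rw [Fin.le_def]; simp [s] at this hji ⊢; lia
          have hjs' : j ≤ s := Fin.castSucc_lt_succ_iff.1 hjs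
          have key : X.δ j (x s.succ - X.δ s.succ w) = 0 := by
            rw [δ_sub, hx j s hjs' hji.ne hs, SSet.δ_comp_δ_apply hjs',
              hw j.castSucc (.inl hji), sub_self]
          rw [δ_add, hw _ (.inl hji)]
          generalize x s.succ - X.δ s.succ w = y at key ⊢
          rw [ht, SSet.δ_comp_σ_of_le_apply hjt, key, σ_zero, add_zero]
        · rw [δ_add, SSet.δ_comp_σ_succ_apply, add_sub_cancel]
        · obtain ⟨j, rfl⟩ := j.eq_succ_of_ne_zero (Fin.ne_zero_of_lt hjs)
          have hsj : s < j := Fin.succ_lt_succ_iff.1 hjs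
          have hij : m + 2 < (j.succ : ℕ) + r := by
            rw [Fin.lt_def] at hsj; simp [s] at hsj ⊢; lia
          obtain ⟨t, ht⟩ := s.eq_castSucc_of_ne_last (Fin.ne_last_of_lt hsj)
          have hji : j.succ ≠ i := by rintro rfl; lia
          have hsj' : s.succ ≤ j.castSucc := Fin.succ_le_castSucc_iff.2 hsj
          obtain ⟨p, hp⟩ : ∃ p : Fin (m + 2), p.castSucc = s.succ :=
            ⟨t.succ, by rw [← ht]; rfl⟩
          have hpj : p ≤ j := by
            rw [← Fin.castSucc_le_castSucc_iff, hp]; exact hsj'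
          have key : X.δ j (x s.succ - X.δ s.succ w) = 0 := by
            rw [δ_sub, ← hp, ← hx p j hpj (hp ▸ hs) hji, ← SSet.δ_comp_δ_apply hpj,
              hw j.succ (.inr hij), sub_self]
          rw [δ_add, hw _ (.inr hij)]
          generalize x s.succ - X.δ s.succ w = y at key ⊢
          rw [← ht, SSet.δ_comp_σ_of_gt_apply (ht.symm ▸ hsj), key, σ_zero, add_zero]
    obtain ⟨w, hw⟩ := upper (m + 2 - i) (by lia)
    exact ⟨w, fun j hj ↦ hw j (by
      obtain h | h := lt_or_gt_of_ne hj
      · exact .inl h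
      · right; have := Fin.lt_def.1 h; lia)⟩

end Horns

/-! ### The group structure on labellings -/

section Model

variable {A : Type u} [AddCommGroup A] {n : ℕ}

variable (A n) in
/-- Normalized cocycles as a subgroup of the group of all cochains. -/
def cocycles (k : SimplexCategory) : AddSubgroup ((⦋n⦌ ⟶ k) → A) where
  carrier := { f |
    (∀ e : ⦋n⦌ ⟶ k, ¬ Function.Injective e.toOrderHom → f e = 0) ∧
    ∀ g : ⦋n + 1⦌ ⟶ k,
      ∑ i : Fin (n + 2), (-1 : ℤ) ^ (i : ℕ) • f (SimplexCategory.δ i ≫ g) = 0 }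
  zero_mem' := ⟨fun _ _ ↦ rfl, fun g ↦ by simp⟩
  add_mem' := fun {f g} hf hg ↦ ⟨fun e he ↦ by simp [hf.1 e he, hg.1 e he], fun e ↦ by
    simp only [Pi.add_apply, smul_add, Finset.sum_add_distrib, hf.2 e, hg.2 e, add_zero]⟩
  neg_mem' := fun {f} hf ↦ ⟨fun e he ↦ by simp [hf.1 e he], fun e ↦ by
    simp only [Pi.neg_apply, smul_neg, Finset.sum_neg_distrib, hf.2 e, neg_zero]⟩

instance (k : SimplexCategory) : AddCommGroup (Labelling A n k) :=
  inferInstanceAs (AddCommGroup (cocycles A n k))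

lemma Labelling.val_zero {k : SimplexCategory} (e : ⦋n⦌ ⟶ k) :
    (0 : Labelling A n k).val e = 0 := rfl

instance kanComplex_cocycleSet : SSet.KanComplex (cocycleSet A n) := by
  let (k : SimplexCategoryᵒᵖ) : AddCommGroup ((cocycleSet A n).obj k) :=
    inferInstanceAs (AddCommGroup (Labelling A n k.unop))
  exact kanComplex_of_addCommGroup fun θ x y ↦ rfl

lemma kanComplex_of_iso {X Y : SSet.{u}} (e : X ≅ Y) [SSet.KanComplex Y] : SSet.KanComplex X := by
  refine kanComplex_of_exists_filler fun m i x hx ↦ ?_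
  have hy : HornCompatible i (fun j ↦ e.hom.app _ (x j)) := by
    cases m with
    | zero => trivial
    | succ m =>
      intro j k hjk hj hk
      rw [← SSet.δ_naturality_apply, ← SSet.δ_naturality_apply, hx j k hjk hj hk]
  obtain ⟨w, hw⟩ := exists_filler hy
  refine ⟨e.inv.app _ w, fun j hj ↦ ?_⟩
  rw [← SSet.δ_naturality_apply, hw j hj]
  simp

end Model

/-! ### Labellings and their faces -/

section Combinatorics

lemma not_injective_comp_left {k l m : SimplexCategory} {e : k ⟶ l} {θ : l ⟶ m}
    (h : ¬ Function.Injective e.toOrderHom) :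
    ¬ Function.Injective (e ≫ θ).toOrderHom := fun h' ↦ h fun a b hab ↦ h' (by simp [hab])

lemma not_injective_of_lt {k l : ℕ} (e : ⦋k⦌ ⟶ ⦋l⦌) (h : l < k) :
    ¬ Function.Injective e.toOrderHom := fun h' ↦ by
  have := Fintype.card_le_of_injective _ h'
  simp at this
  lia

lemma not_injective_δ_σ {k : ℕ} (i : Fin (k + 1)) (j : Fin (k + 2))
    (h₁ : j ≠ i.castSucc) (h₂ : j ≠ i.succ) :
    ¬ Function.Injective (SimplexCategory.δ j ≫ SimplexCategory.σ i).toOrderHom := fun h ↦ by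
  obtain ⟨a, ha⟩ := Fin.exists_succAbove_eq h₁.symm
  obtain ⟨b, hb⟩ := Fin.exists_succAbove_eq h₂.symm
  have hab : a = b := h (by
    change i.predAbove (j.succAbove a) = i.predAbove (j.succAbove b)
    rw [ha, hb, Fin.predAbove_castSucc_self, Fin.predAbove_succ_self])
  rw [hab, hb] at ha
  exact absurd ha (Fin.castSucc_lt_succ).ne'

lemma exists_comp_δ {k l : ℕ} (e : ⦋k⦌ ⟶ ⦋l + 1⦌) (h : k < l + 1) :
    ∃ (j : Fin (l + 2)) (e' : ⦋k⦌ ⟶ ⦋l⦌), e' ≫ SimplexCategory.δ j = e := by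
  obtain ⟨j, e', h⟩ := SimplexCategory.eq_comp_δ_of_not_surjective e (fun h' ↦ by
    have := Fintype.card_le_of_surjective _ h'
    simp at this
    lia)
  exact ⟨j, e', h.symm⟩

/-- The image of `e` together with `i` has at most k + 2 < l + 2 elements, so a vertex other than
`i` is missed. -/
lemma exists_comp_δ_ne {k l : ℕ} (e : ⦋k⦌ ⟶ ⦋l + 1⦌) (h : k < l) (i : Fin (l + 2)) :
    ∃ (j : Fin (l + 2)) (e' : ⦋k⦌ ⟶ ⦋l⦌), j ≠ i ∧ e' ≫ SimplexCategory.δ j = e := by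
  classical
  obtain ⟨j, hj⟩ : ∃ j, j ∉ insert i (Finset.univ.image e.toOrderHom) := by
    by_contra! h'
    have h₁ := Finset.card_le_card (fun j _ ↦ h' j : Finset.univ ⊆ _)
    have h₂ := Finset.card_insert_le i (Finset.univ.image e.toOrderHom)
    have h₃ := Finset.card_image_le (s := Finset.univ) (f := e.toOrderHom)
    simp at h₁ h₂ h₃
    lia
  simp only [Finset.mem_insert, Finset.mem_image, Finset.mem_univ, true_and, not_or,
    not_exists] at hj
  obtain ⟨e', he'⟩ := SimplexCategory.eq_comp_δ_of_not_surjective' e j hj.2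
  exact ⟨j, e', hj.1, he'.symm⟩

/-- Two distinct faces of a simplex intersect in their common face of codimension two. -/
lemma exists_of_comp_δ_eq {k l : ℕ} {p q : Fin (l + 2)} (hpq : p ≤ q) {e e' : ⦋k⦌ ⟶ ⦋l + 1⦌}
    (h : e ≫ SimplexCategory.δ p.castSucc = e' ≫ SimplexCategory.δ q.succ) :
    ∃ d : ⦋k⦌ ⟶ ⦋l⦌, e = d ≫ SimplexCategory.δ q ∧ e' = d ≫ SimplexCategory.δ p := by
  obtain ⟨d, hd⟩ := SimplexCategory.eq_comp_δ_of_not_surjective' e q (fun x hx ↦ by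
    have := SimplexCategory.congr_toOrderHom_apply h x
    change p.castSucc.succAbove (e.toOrderHom x) = q.succ.succAbove (e'.toOrderHom x) at this
    rw [hx, Fin.succAbove_castSucc_of_le _ _ hpq] at this
    exact Fin.succAbove_ne _ _ this.symm)
  refine ⟨d, hd, ?_⟩
  rw [← cancel_mono (SimplexCategory.δ q.succ), ← h, hd, Category.assoc, Category.assoc,
    SimplexCategory.δ_comp_δ hpq]

variable {A : Type u} [AddCommGroup A] {n : ℕ}

/-- If `g` factors through σ_i, its faces i and i + 1 coincide and cancel, and all others are
degenerate. Hence the cocycle condition only needs checking on injective maps. -/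
lemma sum_eq_zero_of_not_injective {k : SimplexCategory} (f : (⦋n⦌ ⟶ k) → A)
    (hf : ∀ e : ⦋n⦌ ⟶ k, ¬ Function.Injective e.toOrderHom → f e = 0) (g : ⦋n + 1⦌ ⟶ k)
    (hg : ¬ Function.Injective g.toOrderHom) :
    ∑ i : Fin (n + 2), (-1 : ℤ) ^ (i : ℕ) • f (SimplexCategory.δ i ≫ g) = 0 := by
  obtain ⟨i, θ, rfl⟩ := SimplexCategory.eq_σ_comp_of_not_injective g hg
  rw [Finset.sum_eq_add i.castSucc i.succ (Fin.castSucc_lt_succ).ne]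
  · rw [SimplexCategory.δ_comp_σ_self_assoc, SimplexCategory.δ_comp_σ_succ_assoc]
    simp [pow_succ]
  · rintro j - ⟨h₁, h₂⟩
    rw [← Category.assoc, hf _ (not_injective_comp_left
      (not_injective_δ_σ i j h₁ h₂)), smul_zero]
  · simp
  · simp

namespace Labelling

lemma eq_zero_of_lt {k : ℕ} (h : k < n) (f : Labelling A n ⦋k⦌) : f = 0 :=
  ext fun e ↦ f.val_of_not_injective e (not_injective_of_lt e h)

lemma ext_id {f g : Labelling A n ⦋n⦌} (h : f.val (𝟙 _) = g.val (𝟙 _)) : f = g := by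
  refine ext fun e ↦ ?_
  by_cases he : Function.Injective e.toOrderHom
  · have := SimplexCategory.mono_iff_injective.2 he
    rwa [SimplexCategory.eq_id_of_mono e]
  · rw [f.val_of_not_injective e he, g.val_of_not_injective e he]

lemma exists_val_id (a : A) : ∃ f : Labelling A n ⦋n⦌, f.val (𝟙 _) = a := by
  classical
  have h (e : ⦋n⦌ ⟶ ⦋n⦌) (he : ¬ Function.Injective e.toOrderHom) :
      (if e = 𝟙 _ then a else 0) = 0 :=
    if_neg (by rintro rfl; exact he Function.injective_id)
  refine ⟨mk (fun e ↦ if e = 𝟙 _ then a else 0) h fun g ↦ sum_eq_zero_of_not_injective _ h g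
    (not_injective_of_lt g (Nat.lt_succ_self n)), ?_⟩
  rw [val_mk, if_pos rfl]

lemma ext_of_faces_ne {k : ℕ} (h : n < k) (i : Fin (k + 2)) {f g : Labelling A n ⦋k + 1⦌}
    (hfg : ∀ j, j ≠ i → f.pullback (SimplexCategory.δ j) = g.pullback (SimplexCategory.δ j)) :
    f = g := by
  refine ext fun e ↦ ?_
  obtain ⟨j, e, hj, rfl⟩ := exists_comp_δ_ne e h i
  rw [← val_pullback, ← val_pullback, hfg j hj]

lemma ext_of_faces {k : ℕ} (h : n ≤ k) {f g : Labelling A n ⦋k + 1⦌}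
    (hfg : ∀ j, f.pullback (SimplexCategory.δ j) = g.pullback (SimplexCategory.δ j)) :
    f = g := by
  refine ext fun e ↦ ?_
  obtain ⟨j, e, rfl⟩ := exists_comp_δ e (Nat.lt_succ_of_le h)
  rw [← val_pullback, ← val_pullback, hfg j]

lemma exists_of_sum_eq_zero (a : Fin (n + 2) → A)
    (ha : ∑ i : Fin (n + 2), (-1 : ℤ) ^ (i : ℕ) • a i = 0) :
    ∃ f : Labelling A n ⦋n + 1⦌, ∀ i, f.val (SimplexCategory.δ i) = a i := by
  classical
  let F (e : ⦋n⦌ ⟶ ⦋n + 1⦌) : A := ∑ i, if e = SimplexCategory.δ i then a i else 0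
  have hF (i) : F (SimplexCategory.δ i) = a i := by
    simp [F, SimplexCategory.δ_injective.eq_iff]
  have hF' (e : ⦋n⦌ ⟶ ⦋n + 1⦌) (he : ¬ Function.Injective e.toOrderHom) : F e = 0 :=
    Finset.sum_eq_zero fun i _ ↦ if_neg (by
      rintro rfl; exact he Fin.succAbove_right_injective)
  refine ⟨mk F hF' fun g ↦ ?_, hF⟩
  by_cases hg : Function.Injective g.toOrderHom
  · have := SimplexCategory.mono_iff_injective.2 hg
    rw [SimplexCategory.eq_id_of_mono g]
    simpa [hF] using ha
  · exact sum_eq_zero_of_not_injective F hF' g hg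

/-- Every map from ⦋n⦌ or ⦋n + 1⦌ to ⦋k + 2⦌ lands in some face, where both the value and the
cocycle condition can be read off. -/
lemma exists_of_cycle {k : ℕ} (h : n ≤ k) (c : Fin (k + 3) → Labelling A n ⦋k + 1⦌)
    (hc : ∀ i j : Fin (k + 2), i ≤ j → (c j.succ).pullback (SimplexCategory.δ i) =
      (c i.castSucc).pullback (SimplexCategory.δ j)) :
    ∃ f : Labelling A n ⦋k + 2⦌, ∀ i, f.pullback (SimplexCategory.δ i) = c i := by
  choose J E hE using fun e : ⦋n⦌ ⟶ ⦋k + 2⦌ ↦ exists_comp_δ e (by lia : n < k + 2)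
  let F (e : ⦋n⦌ ⟶ ⦋k + 2⦌) : A := (c (J e)).val (E e)
  -- Independence of the chosen face: a map landing in two faces lands in their intersection, where
  -- the cycle condition applies.
  have aux (i j : Fin (k + 3)) (hij : i < j) (e e' : ⦋n⦌ ⟶ ⦋k + 1⦌)
      (h : e ≫ SimplexCategory.δ i = e' ≫ SimplexCategory.δ j) :
      (c i).val e = (c j).val e' := by
    obtain ⟨p, rfl⟩ := i.eq_castSucc_of_ne_last (Fin.ne_last_of_lt hij)
    obtain ⟨q, rfl⟩ := j.eq_succ_of_ne_zero (Fin.ne_zero_of_lt hij)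
    have hpq := Fin.castSucc_lt_succ_iff.1 hij
    obtain ⟨d, rfl, rfl⟩ := exists_of_comp_δ_eq hpq h
    rw [← val_pullback, ← val_pullback, hc p q hpq]
  have hF (j : Fin (k + 3)) (e : ⦋n⦌ ⟶ ⦋k + 1⦌) :
      F (e ≫ SimplexCategory.δ j) = (c j).val e := by
    have := hE (e ≫ SimplexCategory.δ j)
    obtain h | h | h := lt_trichotomy (J (e ≫ SimplexCategory.δ j)) j
    · exact aux _ _ h _ _ this
    · dsimp only [F]
      rw [h, cancel_mono] at this
      rw [this, h]
    · exact (aux _ _ h _ _ this.symm).symm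
  refine ⟨mk F (fun e he ↦ ?_) fun g ↦ ?_, fun i ↦ ext fun e ↦ ?_⟩
  · exact (c (J e)).val_of_not_injective _ fun h ↦ he (by
      rw [← hE e]
      exact Fin.succAbove_right_injective.comp h)
  · obtain ⟨j, g, rfl⟩ := exists_comp_δ g (by lia : n + 1 < k + 2)
    simpa only [← Category.assoc, hF] using (c j).sum_val g
  · rw [val_pullback, val_mk, hF]

end Labelling

end Combinatorics

/-! ### Pointed simplices and homotopy groups -/

section PointedSimplices

variable {X : SSet.{u}} {x : X _⦋0⦌} {k : ℕ}

/-- The degenerate simplex on a vertex. -/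
def constSimplex (x : X _⦋0⦌) (k : ℕ) : X _⦋k⦌ := SSet.yonedaEquiv (SSet.const x)

lemma map_constSimplex {l : ℕ} (θ : ⦋l⦌ ⟶ ⦋k⦌) :
    X.map θ.op (constSimplex x k) = constSimplex x l := by
  change X.map θ.op (X.map (SimplexCategory.const _ _ 0).op x) = X.map _ x
  rw [← Functor.map_comp_apply]
  rfl

lemma δ_constSimplex (i : Fin (k + 2)) : X.δ i (constSimplex x (k + 1)) = constSimplex x k := by
  rw [constSimplex, ← SSet.stdSimplex.yonedaEquiv_δ_comp]
  rfl

lemma σ_constSimplex (i : Fin (k + 1)) : X.σ i (constSimplex x k) = constSimplex x (k + 1) := by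
  apply SSet.yonedaEquiv.symm.injective
  rw [← SSet.stdSimplex.σ_comp_yonedaEquiv_symm, constSimplex, Equiv.symm_apply_apply, constSimplex,
    Equiv.symm_apply_apply]
  rfl

/-- The simplex underlying a pointed simplex. -/
def simplex (f : X.PtSimplex k x) : X _⦋k⦌ := SSet.yonedaEquiv f.map

lemma simplex_injective : Function.Injective (simplex : X.PtSimplex k x → X _⦋k⦌) :=
  fun _ _ h ↦ SSet.RelativeMorphism.ext (SSet.yonedaEquiv.injective h)

lemma δ_simplex (f : X.PtSimplex (k + 1) x) (i : Fin (k + 2)) :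
    X.δ i (simplex f) = constSimplex x k := by
  rw [simplex, ← SSet.stdSimplex.yonedaEquiv_δ_comp, SSet.PtSimplex.δ_map, constSimplex]

lemma exists_simplex_eq (z : X _⦋k + 1⦌) (hz : ∀ i, X.δ i z = constSimplex x k) :
    ∃ f : X.PtSimplex (k + 1) x, simplex f = z :=
  ⟨{ map := SSet.yonedaEquiv.symm z
     comm := by
      refine SSet.boundary.hom_ext fun i ↦ ?_
      rw [SSet.boundary.ι_ι_assoc, SSet.stdSimplex.δ_comp_yonedaEquiv_symm, hz, constSimplex,
        Equiv.symm_apply_apply]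
      rfl }, Equiv.apply_symm_apply _ _⟩

lemma simplex_surjective_zero :
    Function.Surjective (simplex : X.PtSimplex 0 x → X _⦋0⦌) := fun z ↦
  ⟨{ map := SSet.yonedaEquiv.symm z
     comm := SSet.boundary.hom_ext₀ }, Equiv.apply_symm_apply _ _⟩

lemma homotopic_of_relStruct {f g : X.PtSimplex k x}
    (r : SSet.PtSimplex.RelStruct f g (Fin.last k)) : Homotopic (simplex f) (simplex g) := by
  refine ⟨?_, SSet.yonedaEquiv r.map, fun i ↦ ?_, ?_, ?_⟩
  · cases k with
    | zero => trivial
    | succ k => exact fun i ↦ by rw [δ_simplex, δ_simplex]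
  · have hi : i.castSucc.castSucc < (Fin.last k).castSucc := by
      simp [Fin.lt_def]
    rw [← SSet.stdSimplex.yonedaEquiv_δ_comp, r.δ_map_of_lt _ hi]
    -- The reflexivity homotopy is the degenerate simplex s_k f, so the faces d_i s_k f demanded by
    -- `Homotopic` are the base point.
    have := (SSet.PtSimplex.RelStruct.refl f (Fin.last k)).δ_map_of_lt _ hi
    rw [← this, SSet.stdSimplex.yonedaEquiv_δ_comp]
    congr 1
    apply SSet.yonedaEquiv.symm.injective
    rw [← SSet.stdSimplex.σ_comp_yonedaEquiv_symm, simplex, Equiv.symm_apply_apply,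
      Equiv.symm_apply_apply]
    rfl
  · rw [← SSet.stdSimplex.yonedaEquiv_δ_comp, r.δ_castSucc_map, simplex]
  · rw [← Fin.succ_last, ← SSet.stdSimplex.yonedaEquiv_δ_comp, r.δ_succ_map, simplex]

/-- In a minimal simplicial set, the homotopy classes are the pointed simplices. -/
def piEquiv (hX : IsMinimal X) : Pi k X x ≃ X.PtSimplex k x where
  toFun := Quot.lift id fun _ _ ⟨r⟩ ↦ simplex_injective (hX _ _ _ (homotopic_of_relStruct r))
  invFun := Quot.mk _
  left_inv := by rintro ⟨f⟩; rfl
  right_inv _ := rfl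

lemma isComposition_iff {n : ℕ} {f g fg : X.PtSimplex (n + 1) x} :
    IsComposition f g fg ↔ ∃ y : X _⦋n + 2⦌,
      (∀ i : Fin n, X.δ i.castSucc.castSucc.castSucc y = constSimplex x (n + 1)) ∧
      X.δ (Fin.last n).castSucc.castSucc y = simplex g ∧
      X.δ (Fin.last (n + 1)).castSucc y = simplex fg ∧
      X.δ (Fin.last (n + 2)) y = simplex f := by
  constructor
  · rintro ⟨i, hi, ⟨m⟩⟩
    obtain rfl : i = Fin.last n := by ext; simpa using hi
    refine ⟨SSet.yonedaEquiv m.map, fun i ↦ ?_, ?_, ?_, ?_⟩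
    · rw [← SSet.stdSimplex.yonedaEquiv_δ_comp, m.δ_map_of_lt _ (by simp [Fin.lt_def]),
        constSimplex]
    · rw [← SSet.stdSimplex.yonedaEquiv_δ_comp, m.δ_castSucc_castSucc_map, simplex]
    · rw [← Fin.succ_last, Fin.castSucc_succ, ← SSet.stdSimplex.yonedaEquiv_δ_comp,
        m.δ_succ_castSucc_map, simplex]
    · rw [← Fin.succ_last, ← Fin.succ_last, ← SSet.stdSimplex.yonedaEquiv_δ_comp,
        m.δ_succ_succ_map, simplex]
  · rintro ⟨y, h₁, h₂, h₃, h₄⟩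
    refine ⟨Fin.last n, rfl, ⟨{
      map := SSet.yonedaEquiv.symm y
      δ_castSucc_castSucc_map := ?_
      δ_succ_castSucc_map := ?_
      δ_succ_succ_map := ?_
      δ_map_of_lt := fun j hj ↦ ?_
      δ_map_of_gt := fun j hj ↦ absurd hj (by simp [Fin.lt_def]; lia) }⟩⟩
    · rw [SSet.stdSimplex.δ_comp_yonedaEquiv_symm, h₂, simplex, Equiv.symm_apply_apply]
    · rw [SSet.stdSimplex.δ_comp_yonedaEquiv_symm, ← Fin.castSucc_succ, Fin.succ_last, h₃,
        simplex, Equiv.symm_apply_apply]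
    · rw [SSet.stdSimplex.δ_comp_yonedaEquiv_symm, Fin.succ_last, Fin.succ_last, h₄,
        simplex, Equiv.symm_apply_apply]
    · obtain ⟨i, rfl⟩ : ∃ i : Fin n, j = i.castSucc.castSucc.castSucc :=
        ⟨⟨j, by simpa [Fin.lt_def] using hj⟩, rfl⟩
      rw [SSet.stdSimplex.δ_comp_yonedaEquiv_symm, h₁, constSimplex, Equiv.symm_apply_apply]

end PointedSimplices

/-! ### Simplicial sets over, or isomorphic to, the set of cocycles -/

section Model

variable {A : Type u} [AddCommGroup A] {n : ℕ} {X : SSet.{u}} (L : X ⟶ cocycleSet A n) {k : ℕ}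

/-- The labelling of a simplex given by a morphism to `cocycleSet A n`. -/
def label (y : X _⦋k⦌) : Labelling A n ⦋k⦌ := L.app (op ⦋k⦌) y

/-- The label of an `n`-simplex. -/
def topLabel (y : X _⦋n⦌) : A := (label L y).val (𝟙 _)

lemma label_map {l : ℕ} (θ : ⦋l⦌ ⟶ ⦋k⦌) (y : X _⦋k⦌) :
    label L (X.map θ.op y) = (label L y).pullback θ :=
  ConcreteCategory.congr_hom (L.naturality θ.op) y

lemma label_δ (i : Fin (k + 2)) (y : X _⦋k + 1⦌) :
    label L (X.δ i y) = (label L y).pullback (SimplexCategory.δ i) := label_map L _ y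

lemma topLabel_map (e : ⦋n⦌ ⟶ ⦋k⦌) (y : X _⦋k⦌) :
    topLabel L (X.map e.op y) = (label L y).val e := by
  rw [topLabel, label_map, Labelling.val_pullback_id]

lemma topLabel_δ (i : Fin (n + 2)) (y : X _⦋n + 1⦌) :
    topLabel L (X.δ i y) = (label L y).val (SimplexCategory.δ i) := topLabel_map L _ y

lemma sum_topLabel (y : X _⦋n + 1⦌) :
    ∑ i : Fin (n + 2), (-1 : ℤ) ^ (i : ℕ) • topLabel L (X.δ i y) = 0 := by
  simpa [topLabel_δ] using (label L y).sum_val (𝟙 _)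

lemma topLabel_degenerate (y : X _⦋n⦌) (hy : y ∈ X.degenerate n) : topLabel L y = 0 := by
  obtain ⟨m, hm, f, y, rfl⟩ := hy
  rw [topLabel_map]
  exact (label L y).val_of_not_injective _ (not_injective_of_lt f hm)

lemma topLabel_δ_σ (y : X _⦋n⦌) (i : Fin (n + 1)) (j : Fin (n + 2)) :
    topLabel L (X.δ j (X.σ i y)) =
      if j = i.castSucc ∨ j = i.succ then topLabel L y else 0 := by
  split_ifs with h
  · obtain rfl | rfl := h
    · rw [SSet.δ_comp_σ_self_apply]
    · rw [SSet.δ_comp_σ_succ_apply]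
  · rw [not_or] at h
    have : X.δ j (X.σ i y) = X.map (SimplexCategory.δ j ≫ SimplexCategory.σ i).op y := by
      rw [op_comp, Functor.map_comp_apply]
      rfl
    rw [this, topLabel_map]
    exact (label L y).val_of_not_injective _ (not_injective_δ_σ i j h.1 h.2)

lemma topLabel_constSimplex (hn : 1 ≤ n) (x : X _⦋0⦌) : topLabel L (constSimplex x n) = 0 :=
  topLabel_degenerate L _ ⟨0, hn, _, x, rfl⟩

variable [IsIso L]

lemma label_bijective : Function.Bijective (label L : X _⦋k⦌ → Labelling A n ⦋k⦌) :=
  (isIso_iff_bijective (L.app (op ⦋k⦌))).1 inferInstance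

lemma topLabel_bijective : Function.Bijective (topLabel L) :=
  ⟨fun _ _ h ↦ (label_bijective L).1 (Labelling.ext_id h), fun a ↦ by
    obtain ⟨f, rfl⟩ := Labelling.exists_val_id (n := n) a
    obtain ⟨y, rfl⟩ := (label_bijective L).2 f
    exact ⟨y, rfl⟩⟩

include L in
lemma subsingleton_of_lt (h : k < n) : Subsingleton (X _⦋k⦌) :=
  ⟨fun _ _ ↦ (label_bijective L).1
    ((Labelling.eq_zero_of_lt h _).trans (Labelling.eq_zero_of_lt h _).symm)⟩

include L in
lemma ext_of_δ (h : n ≤ k) {y z : X _⦋k + 1⦌} (hyz : ∀ i, X.δ i y = X.δ i z) : y = z :=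
  (label_bijective L).1 (Labelling.ext_of_faces h fun i ↦ by rw [← label_δ, ← label_δ, hyz])

include L in
lemma hasStandardLowSimplices : HasStandardLowSimplices A n X := by
  refine ⟨fun k hk ↦ ?_, Equiv.ofBijective _ (topLabel_bijective L), topLabel_degenerate L,
    sum_topLabel L, fun a ha ↦ ?_, topLabel_δ_σ L⟩
  · have := subsingleton_of_lt L hk
    obtain ⟨y, -⟩ := (label_bijective L).2 (0 : Labelling A n ⦋k⦌)
    exact ⟨Unique.mk' _ (h₁ := ⟨y⟩)⟩
  · obtain ⟨f, hf⟩ := Labelling.exists_of_sum_eq_zero a ha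
    obtain ⟨y, rfl⟩ := (label_bijective L).2 f
    simp only [Equiv.ofBijective_apply]
    exact ⟨y, fun i ↦ by rw [topLabel_δ, hf], fun z hz ↦ ext_of_δ L le_rfl fun i ↦
      (topLabel_bijective L).1 (by rw [hz, topLabel_δ, hf])⟩

include L in
lemma existsUnique_of_isCycle (hk : n + 1 ≤ k) (c : Fin (k + 2) → X _⦋k⦌) (hc : IsCycle c) :
    ∃! y : X _⦋k + 1⦌, ∀ i, X.δ i y = c i := by
  obtain ⟨k, rfl⟩ := Nat.exists_eq_add_one_of_ne_zero (by lia : k ≠ 0)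
  obtain ⟨f, hf⟩ := Labelling.exists_of_cycle (Nat.le_of_succ_le_succ hk) (fun i ↦ label L (c i))
    fun i j hij ↦ by rw [← label_δ, ← label_δ, hc i j hij]
  obtain ⟨y, rfl⟩ := (label_bijective L).2 f
  have hy i : X.δ i y = c i := (label_bijective L).1 (by rw [label_δ, hf])
  exact ⟨y, hy, fun z hz ↦ ext_of_δ L (by lia) fun i ↦ by rw [hz, hy]⟩

include L in
lemma isCanonicalCompletion : IsCanonicalCompletion (skeleton A n) X where
  extends_skeleton := nonempty_truncation_iso (asIso L)
  fill _ := existsUnique_of_isCycle L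

include L in
lemma isMinimal : IsMinimal X := by
  rintro k _ _ ⟨h, w, h₁, h₂, h₃⟩
  obtain hk | rfl | hk := lt_trichotomy k n
  · exact (subsingleton_of_lt L hk).elim _ _
  -- The entries d_i s_n x with i < n have label 0, so the alternating sum over the homotopy reduces
  -- to ± the difference of the two labels.
  · have := sum_topLabel L w
    rw [Fin.sum_univ_castSucc, Fin.sum_univ_castSucc, Finset.sum_eq_zero, h₂, h₃] at this
    · apply (topLabel_bijective L).1
      rw [← sub_eq_zero]
      simpa [pow_succ, ← sub_eq_add_neg, ← smul_sub,
        (isUnit_neg_one.pow k : IsUnit ((-1 : ℤ) ^ k)).smul_eq_zero] using this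
    · intro i _
      rw [h₁, topLabel_δ_σ, if_neg (by simp [Fin.ext_iff]; lia), smul_zero]
  · obtain ⟨k, rfl⟩ := Nat.exists_eq_add_one_of_ne_zero (by lia : k ≠ 0)
    exact ext_of_δ L (by lia) h

include L in
lemma isEilenbergMacLaneSpace (hn : 1 ≤ n) (x : X _⦋0⦌) : IsEilenbergMacLaneSpace A n X x where
  kan := kanComplex_of_iso (asIso L)
  trivial k hk := by
    have : Subsingleton (X.PtSimplex k x) := by
      obtain hk | hk := lt_or_gt_of_ne hk
      · have := subsingleton_of_lt L hk
        exact simplex_injective.subsingleton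
      · obtain ⟨k, rfl⟩ := Nat.exists_eq_add_one_of_ne_zero (by lia : k ≠ 0)
        exact ⟨fun f g ↦ simplex_injective (ext_of_δ L (by lia) fun i ↦ by
          rw [δ_simplex, δ_simplex])⟩
    have := (piEquiv (x := x) (k := k) (isMinimal L)).injective.subsingleton
    exact ⟨Unique.mk' _ (h₁ := ⟨Quot.mk _ .const⟩)⟩
  iso := by
    obtain ⟨n, rfl⟩ := Nat.exists_eq_add_one_of_ne_zero (by lia : n ≠ 0)
    have := subsingleton_of_lt L (Nat.lt_succ_self n)
    refine ⟨(piEquiv (isMinimal L)).trans (Equiv.ofBijective (fun f ↦ topLabel L (simplex f))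
      ⟨(topLabel_bijective L).1.comp simplex_injective,
        (topLabel_bijective L).2.comp fun z ↦ exists_simplex_eq z fun i ↦
          Subsingleton.elim _ _⟩), fun f g fg h ↦ ?_⟩
    change topLabel L (simplex fg) = topLabel L (simplex f) + topLabel L (simplex g)
    obtain ⟨y, h₁, h₂, h₃, h₄⟩ := isComposition_iff.1 h
    have := sum_topLabel L y
    rw [Fin.sum_univ_castSucc, Fin.sum_univ_castSucc, Fin.sum_univ_castSucc,
      Finset.sum_eq_zero, h₂, h₃, h₄] at this
    · have h : (-1 : ℤ) ^ n • (topLabel L (simplex f) + topLabel L (simplex g) -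
          topLabel L (simplex fg)) = 0 := by
        rw [← this]
        simp [pow_succ, smul_sub, smul_add]
        abel
      rw [(isUnit_neg_one.pow n).smul_eq_zero, sub_eq_zero] at h
      exact h.symm
    · intro i _
      rw [h₁, topLabel_constSimplex L hn, smul_zero]

end Model

/-! ### Comparing fillers, and cocycles as morphisms -/

section Uniqueness

variable {X : SSet.{u}}

lemma δ_δ_eq_of_ne {k : ℕ} {w w' : X _⦋k + 2⦌} (i : Fin (k + 3))
    (h : ∀ j, j ≠ i → X.δ j w = X.δ j w') (j : Fin (k + 2)) :
    X.δ j (X.δ i w) = X.δ j (X.δ i w') := by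
  obtain hij | hij := lt_or_ge j.castSucc i
  · obtain ⟨i, rfl⟩ := i.eq_succ_of_ne_zero (Fin.ne_zero_of_lt hij)
    rw [SSet.δ_comp_δ_apply (Fin.castSucc_lt_succ_iff.1 hij),
      SSet.δ_comp_δ_apply (Fin.castSucc_lt_succ_iff.1 hij), h _ hij.ne]
  · obtain ⟨i, rfl⟩ := i.eq_castSucc_of_ne_last (ne_of_lt (hij.trans_lt (Fin.castSucc_lt_last j)))
    have hij' := Fin.castSucc_le_castSucc_iff.1 hij
    rw [← SSet.δ_comp_δ_apply hij', ← SSet.δ_comp_δ_apply hij',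
      h _ (Fin.castSucc_lt_succ_iff.2 hij').ne']

/-- If two simplices of a Kan complex have the same faces except the `i`-th ones, then their
`i`-th faces are homotopic, provided that `i` is not the last index. -/
lemma homotopic_of_δ_eq [SSet.KanComplex X] {k : ℕ} {w w' : X _⦋k + 2⦌} (i : Fin (k + 2))
    (h : ∀ j, j ≠ i.castSucc → X.δ j w = X.δ j w') :
    Homotopic (X.δ i.castSucc w) (X.δ i.castSucc w') := by
  -- The horn (s d_0 w, …, s d_{k+1} w, w, w') with entry i omitted, s being the last degeneracy;
  -- the missing face of a filler is the homotopy.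
  let x : Fin (k + 4) → X _⦋k + 2⦌ :=
    Fin.lastCases w' (Fin.lastCases w fun j : Fin (k + 2) ↦ X.σ (Fin.last (k + 1))
      (X.δ j.castSucc w))
  have x₁ : x (Fin.last (k + 3)) = w' := by simp [x]
  have x₂ : x (Fin.last (k + 2)).castSucc = w := by simp [x]
  have x₃ (j : Fin (k + 2)) : x j.castSucc.castSucc = X.σ (Fin.last (k + 1))
      (X.δ j.castSucc w) := by simp [x]
  have hx : HornCompatible i.castSucc.castSucc x := by
    intro j l hjl hj hl
    induction l using Fin.lastCases with
    | last =>
      rw [Fin.succ_last, x₁]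
      induction j using Fin.lastCases with
      | last => rw [x₂, h _ (Fin.castSucc_lt_last i).ne']
      | cast j =>
        rw [x₃, ← Fin.succ_last, SSet.δ_comp_σ_succ_apply, h _ (fun h' ↦ hj (h' ▸ rfl))]
    | cast l =>
      obtain ⟨j, rfl⟩ := j.eq_castSucc_of_ne_last
        (ne_of_lt (hjl.trans_lt (Fin.castSucc_lt_last l)))
      rw [Fin.castSucc_le_castSucc_iff] at hjl
      rw [Fin.succ_castSucc, x₃]
      induction l using Fin.lastCases with
      | last => rw [Fin.succ_last, x₂, SSet.δ_comp_σ_self_apply]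
      | cast l =>
        obtain ⟨j, rfl⟩ := j.eq_castSucc_of_ne_last
          (ne_of_lt (hjl.trans_lt (Fin.castSucc_lt_last l)))
        rw [Fin.succ_castSucc, x₃, ← Fin.succ_last,
          SSet.δ_comp_σ_of_le_apply (Fin.castSucc_le_castSucc_iff.2 (Fin.le_last j)),
          SSet.δ_comp_σ_of_le_apply (Fin.castSucc_le_castSucc_iff.2 (Fin.le_last l)),
          ← Fin.succ_castSucc, SSet.δ_comp_δ_apply hjl]
  obtain ⟨v, hv⟩ := exists_filler hx
  refine ⟨fun j ↦ δ_δ_eq_of_ne _ h j, X.δ i.castSucc.castSucc v, fun j ↦ ?_, ?_, ?_⟩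
  · obtain hij | hij := lt_or_ge j.castSucc i
    · obtain ⟨i, rfl⟩ := i.eq_succ_of_ne_zero (Fin.ne_zero_of_lt hij)
      have hij' := Fin.castSucc_lt_succ_iff.1 hij
      rw [← Fin.succ_castSucc, ← Fin.succ_castSucc, SSet.δ_comp_δ_apply (by simpa using hij'),
        hv _ (by simpa [Fin.ext_iff, Fin.lt_def] using hij.ne), x₃, ← Fin.succ_last,
        SSet.δ_comp_σ_of_le_apply (Fin.castSucc_le_castSucc_iff.2 (Fin.le_last i)),
        SSet.δ_comp_σ_of_le_apply (Fin.castSucc_le_castSucc_iff.2 (Fin.le_last j)),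
        SSet.δ_comp_δ_apply (by simpa using hij')]
    · obtain ⟨i, rfl⟩ := i.eq_castSucc_of_ne_last
        (ne_of_lt (hij.trans_lt (Fin.castSucc_lt_last j)))
      have hij' := Fin.castSucc_le_castSucc_iff.1 hij
      rw [← SSet.δ_comp_δ_apply (by simpa using hij'), Fin.succ_castSucc, Fin.succ_castSucc,
        hv _ (by simp [Fin.ext_iff]; rw [Fin.le_def] at hij'; lia), x₃, ← Fin.succ_last,
        SSet.δ_comp_σ_of_le_apply (Fin.castSucc_le_castSucc_iff.2 (Fin.le_last i)),
        SSet.δ_comp_σ_of_le_apply (Fin.castSucc_le_castSucc_iff.2 (Fin.le_last j)),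
        ← Fin.succ_castSucc, SSet.δ_comp_δ_apply (by simpa using hij')]
  · rw [← SSet.δ_comp_δ_apply (by simpa using Fin.le_last i), Fin.succ_castSucc, Fin.succ_last,
      hv _ (by simp [Fin.ext_iff]; lia), x₂]
  · rw [← SSet.δ_comp_δ_apply (Fin.le_last _), Fin.succ_last,
      hv _ (by simp [Fin.ext_iff]; lia), x₁]

/-- `cocycleSet A n` represents normalized cocycles: a simplex is sent to the pullback of `t` along
its classifying map. -/
lemma exists_hom {A : Type u} [AddCommGroup A] {n : ℕ} (t : X _⦋n⦌ → A)
    (h₁ : ∀ y ∈ X.degenerate n, t y = 0)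
    (h₂ : ∀ y : X _⦋n + 1⦌, ∑ i : Fin (n + 2), (-1 : ℤ) ^ (i : ℕ) • t (X.δ i y) = 0) :
    ∃ L : X ⟶ cocycleSet A n, ∀ y, topLabel L y = t y := by
  let F (k : SimplexCategoryᵒᵖ) (y : X.obj k) : Labelling A n k.unop :=
    .mk (fun e ↦ t (X.map e.op y)) (fun e he ↦ h₁ _ (by
        cases n with
        | zero => exact absurd (fun a b _ ↦ Subsingleton.elim (α := Fin 1) a b) he
        | succ n =>
          obtain ⟨i, θ, rfl⟩ := SimplexCategory.eq_σ_comp_of_not_injective e he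
          rw [op_comp, Functor.map_comp_apply]
          exact X.σ_mem_degenerate i _)) fun g ↦ by
      rw [← h₂ (X.map g.op y)]
      refine Finset.sum_congr rfl fun i _ ↦ ?_
      rw [op_comp, Functor.map_comp_apply]
      rfl
  refine ⟨{ app k := ↾(F k), naturality k l θ := ?_ }, fun y ↦ ?_⟩
  · ext y
    refine Labelling.ext fun e ↦ ?_
    change t (X.map e.op (X.map θ y)) = t (X.map (e ≫ θ.unop).op y)
    rw [op_comp, Functor.map_comp_apply]
    rfl
  · change t (X.map (𝟙 _) y) = t y
    rw [CategoryTheory.Functor.map_id]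
    rfl

end Uniqueness

/-! ### Minimal Eilenberg–Mac Lane spaces in dimensions up to n + 1 -/

section Labels

variable {A : Type u} [AddCommGroup A] {n : ℕ} {X : SSet.{u}} {x : X _⦋0⦌}

/-- Once the dimension below has only one simplex, every simplex is pointed, and minimality
identifies pointed simplices with homotopy classes. -/
lemma subsingleton_of_isMinimal (hX : IsMinimal X)
    (hpi : ∀ k < n, Subsingleton (Pi k X x)) (k : ℕ) (hk : k < n) : Subsingleton (X _⦋k⦌) := by
  induction k with
  | zero =>
    have := hpi 0 hk
    have := (piEquiv (x := x) (k := 0) hX).symm.injective.subsingleton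
    exact (simplex_surjective_zero (x := x)).subsingleton
  | succ k ih =>
    have := ih (by lia)
    have := hpi (k + 1) hk
    have := (piEquiv (x := x) (k := k + 1) hX).symm.injective.subsingleton
    have h : Function.Surjective (simplex : X.PtSimplex (k + 1) x → X _⦋k + 1⦌) :=
      fun z ↦ exists_simplex_eq z fun i ↦ Subsingleton.elim _ _
    exact h.subsingleton

variable (X x A n) in
/-- A group-valued labelling of the `(n+1)`-simplices which is bijective and computes the product of
the homotopy group. -/
structure GroupLabel where
  /-- The labelling. -/
  equiv : X _⦋n + 1⦌ ≃ A
  composition (y : X _⦋n + 2⦌)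
    (hy : ∀ i : Fin n, X.δ i.castSucc.castSucc.castSucc y = constSimplex x (n + 1)) :
    equiv (X.δ (Fin.last (n + 1)).castSucc y) =
      equiv (X.δ (Fin.last (n + 2)) y) + equiv (X.δ (Fin.last n).castSucc.castSucc y)

lemma nonempty_groupLabel (hX : IsMinimal X) [Subsingleton (X _⦋n⦌)]
    (h : IsEilenbergMacLaneSpace A (n + 1) X x) : Nonempty (GroupLabel A n X x) := by
  obtain ⟨φ, hφ⟩ := h.iso
  have hs : Function.Bijective (simplex : X.PtSimplex (n + 1) x → X _⦋n + 1⦌) :=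
    ⟨simplex_injective, fun z ↦ exists_simplex_eq z fun i ↦ Subsingleton.elim _ _⟩
  let e := Equiv.ofBijective _ hs
  refine ⟨⟨e.symm.trans ((piEquiv hX).symm.trans φ), fun y hy ↦ ?_⟩⟩
  refine hφ (e.symm (X.δ (Fin.last (n + 2)) y))
    (e.symm (X.δ (Fin.last n).castSucc.castSucc y)) _ (isComposition_iff.2 ⟨y, hy, ?_, ?_, ?_⟩)
  all_goals exact (e.apply_symm_apply _).symm

namespace GroupLabel

variable (t : GroupLabel A n X x)

lemma equiv_constSimplex : t.equiv (constSimplex x (n + 1)) = 0 := by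
  simpa only [δ_constSimplex, left_eq_add] using
    t.composition (constSimplex x (n + 2)) fun i ↦ δ_constSimplex _

/-- The tuple `(a_0, …, a_n, u, v)` is the boundary of a simplex. -/
def IsBoundary (a : Fin (n + 1) → A) (u v : A) : Prop :=
  ∃ y : X _⦋n + 2⦌, (∀ i : Fin (n + 1), t.equiv (X.δ i.castSucc.castSucc y) = a i) ∧
    t.equiv (X.δ (Fin.last (n + 1)).castSucc y) = u ∧ t.equiv (X.δ (Fin.last (n + 2)) y) = v

variable [Subsingleton (X _⦋n⦌)]

section Kan

variable [SSet.KanComplex X]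

omit [Subsingleton (X _⦋n⦌)] in
lemma eq_of_isBoundary (hX : IsMinimal X) {a : Fin (n + 1) → A} {u u' v : A}
    (h : t.IsBoundary a u v) (h' : t.IsBoundary a u' v) : u = u' := by
  obtain ⟨y, h₁, rfl, h₃⟩ := h
  obtain ⟨y', h₁', rfl, h₃'⟩ := h'
  refine congrArg t.equiv (hX _ _ _ (homotopic_of_δ_eq _ fun j hj ↦ t.equiv.injective ?_))
  induction j using Fin.lastCases with
  | last => rw [h₃, h₃']
  | cast j =>
    induction j using Fin.lastCases with
    | last => exact absurd rfl hj
    | cast j => rw [h₁, h₁']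

lemma exists_isBoundary (a : Fin (n + 1) → A) (v : A) : ∃ u, t.IsBoundary a u v := by
  let z : Fin (n + 3) → X _⦋n + 1⦌ :=
    Fin.lastCases (t.equiv.symm v) (Fin.lastCases (constSimplex x _) fun j ↦ t.equiv.symm (a j))
  -- All horns are compatible here, as there is at most one n-simplex; the constant simplex only
  -- occupies the omitted place.
  obtain ⟨y, hy⟩ := exists_filler (i := (Fin.last (n + 1)).castSucc) (x := z)
    fun j l _ _ _ ↦ Subsingleton.elim _ _
  refine ⟨_, y, fun i ↦ ?_, rfl, ?_⟩
  · rw [hy _ (by simp [Fin.ext_iff]; lia)]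
    simp [z]
  · rw [hy _ (by simp [Fin.ext_iff])]
    simp [z]

lemma isBoundary_single_last (b a : A) : t.IsBoundary (Pi.single (Fin.last n) b) (a + b) a := by
  obtain ⟨u, y, h₁, rfl, h₃⟩ := t.exists_isBoundary (Pi.single (Fin.last n) b) a
  refine ⟨y, h₁, ?_, h₃⟩
  rw [t.composition y fun i ↦ t.equiv.injective ?_, h₃, h₁, Pi.single_eq_same]
  rw [h₁, t.equiv_constSimplex, Pi.single_eq_of_ne (Fin.castSucc_lt_last i).ne]

/-- The sum appears on the omitted face n + 2 of the horn (r_0, …, r_n, y', –, y), where r_j has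
boundary (0, …, 0, b_j, a_j + b_j, a_j). -/
lemma isBoundary_add {a b : Fin (n + 1) → A} {u v w : A} (ha : t.IsBoundary a v w)
    (hb : t.IsBoundary b u v) : t.IsBoundary (a + b) u w := by
  obtain ⟨y, ha₁, ha₂, ha₃⟩ := ha
  obtain ⟨y', hb₁, hb₂, hb₃⟩ := hb
  choose r hr₁ hr₂ hr₃ using fun j : Fin (n + 1) ↦ t.isBoundary_single_last (b j) (a j)
  let z : Fin (n + 4) → X _⦋n + 2⦌ :=
    Fin.lastCases y (Fin.lastCases (constSimplex x _) (Fin.lastCases y' r))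
  have z₁ : z (Fin.last (n + 3)) = y := by simp [z]
  have z₂ : z (Fin.last (n + 1)).castSucc.castSucc = y' := by simp [z]
  have z₃ (j : Fin (n + 1)) : z j.castSucc.castSucc.castSucc = r j := by simp [z]
  have hz : HornCompatible (Fin.last (n + 2)).castSucc z := by
    intro j l hjl hj hl
    apply t.equiv.injective
    obtain ⟨j, rfl⟩ := j.eq_castSucc_of_ne_last (fun h ↦ hj (h ▸ rfl))
    induction l using Fin.lastCases with
    | last =>
      rw [Fin.succ_last, z₁]
      induction j using Fin.lastCases with
      | last => rw [z₂, ha₂, hb₃]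
      | cast j => rw [z₃, ha₁, hr₃]
    | cast l =>
      obtain ⟨l, rfl⟩ := l.eq_castSucc_of_ne_last (fun h ↦ hl (h ▸ rfl))
      obtain ⟨j, rfl⟩ := j.eq_castSucc_of_ne_last
        (ne_of_lt ((Fin.castSucc_le_castSucc_iff.1 hjl).trans_lt (Fin.castSucc_lt_last l)))
      rw [Fin.succ_castSucc, Fin.succ_castSucc, z₃]
      simp only [Fin.castSucc_le_castSucc_iff] at hjl
      induction l using Fin.lastCases with
      | last =>
        rw [Fin.succ_last, z₂, hb₁, hr₁, Pi.single_eq_same]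
      | cast l =>
        rw [Fin.succ_castSucc, z₃, hr₁, hr₁, Pi.single_eq_of_ne (Fin.castSucc_lt_last l).ne,
          Pi.single_eq_of_ne (hjl.trans_lt (Fin.castSucc_lt_last l)).ne]
  obtain ⟨V, hV⟩ := exists_filler hz
  refine ⟨X.δ (Fin.last (n + 2)).castSucc V, fun i ↦ ?_, ?_, ?_⟩
  · rw [← Fin.succ_last, Fin.castSucc_succ, SSet.δ_comp_δ_apply (by simp [Fin.le_def]),
      hV _ (by simp [Fin.ext_iff]; lia), z₃, hr₂, Pi.add_apply]
  · rw [← Fin.succ_last (n + 1), Fin.castSucc_succ, SSet.δ_comp_δ_apply le_rfl,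
      hV _ (by simp [Fin.ext_iff]), z₂, hb₂]
  · rw [← SSet.δ_comp_δ_apply le_rfl, Fin.succ_last, hV _ (by simp [Fin.ext_iff]), z₁, ha₃]

omit [SSet.KanComplex X] in
lemma constSimplex_of_mem_degenerate (y : X _⦋n + 1⦌)
    (hy : y ∈ X.degenerate (n + 1)) : y = constSimplex x (n + 1) := by
  rw [SSet.degenerate_eq_iUnion_range_σ, Set.mem_iUnion] at hy
  obtain ⟨i, y, rfl⟩ := hy
  rw [Subsingleton.elim y (constSimplex x n), σ_constSimplex]

omit [SSet.KanComplex X] in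
lemma isBoundary_degenerate (i : Fin n) (c : A) :
    t.IsBoundary (Pi.single i.castSucc c + Pi.single i.succ c) 0 0 := by
  have key (i : Fin (n + 2)) (j : Fin (n + 3)) (z : X _⦋n + 1⦌) (h₁ : j ≠ i.castSucc)
      (h₂ : j ≠ i.succ) : t.equiv (X.δ j (X.σ i z)) = 0 := by
    have : X.δ j (X.σ i z) = X.map (SimplexCategory.δ j ≫ SimplexCategory.σ i).op z := by
      rw [op_comp, Functor.map_comp_apply]
      rfl
    obtain ⟨l, θ, h⟩ := SimplexCategory.eq_σ_comp_of_not_injective _ (not_injective_δ_σ i j h₁ h₂)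
    rw [constSimplex_of_mem_degenerate (x := x) (X.δ j (X.σ i z)), t.equiv_constSimplex]
    rw [this, h, op_comp, Functor.map_comp_apply]
    exact X.σ_mem_degenerate l _
  refine ⟨X.σ i.castSucc.castSucc (t.equiv.symm c), fun j ↦ ?_, ?_, ?_⟩
  · by_cases h₁ : j = i.castSucc
    · subst h₁
      rw [SSet.δ_comp_σ_self_apply, Equiv.apply_symm_apply, Pi.add_apply, Pi.single_eq_same,
        Pi.single_eq_of_ne (Fin.castSucc_lt_succ).ne, add_zero]
    by_cases h₂ : j = i.succ
    · subst h₂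
      rw [← Fin.succ_castSucc, ← Fin.succ_castSucc, SSet.δ_comp_σ_succ_apply,
        Equiv.apply_symm_apply, Pi.add_apply, Pi.single_eq_same,
        Pi.single_eq_of_ne (Fin.castSucc_lt_succ).ne', zero_add]
    rw [key _ _ _ (by simpa using h₁) (fun h ↦ h₂ (by simpa [Fin.ext_iff] using h)), Pi.add_apply,
      Pi.single_eq_of_ne h₁, Pi.single_eq_of_ne h₂, add_zero]
  · exact key _ _ _ (by simp [Fin.ext_iff]; lia) (by simp [Fin.ext_iff]; lia)
  · exact key _ _ _ (by simp [Fin.ext_iff]; lia) (by simp [Fin.ext_iff]; lia)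

/-- The entry u is a function G(a, v), and by `isBoundary_add` G is an action of A^{n+1} on A. -/
lemma exists_addMonoidHom (hX : IsMinimal X) :
    ∃ g : (Fin (n + 1) → A) →+ A, ∀ a u v, t.IsBoundary a u v ↔ u = g a + v := by
  choose G hG using t.exists_isBoundary
  have hG' {a u v} : t.IsBoundary a u v ↔ u = G a v :=
    ⟨fun h ↦ t.eq_of_isBoundary hX h (hG a v), fun h ↦ h ▸ hG a v⟩
  have hadd (a b : Fin (n + 1) → A) (v : A) : G (a + b) v = G b (G a v) :=
    (hG'.1 (t.isBoundary_add (hG a v) (hG b _))).symm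
  have hsingle (c v : A) : G (Pi.single (Fin.last n) c) v = v + c :=
    (hG'.1 (t.isBoundary_single_last c v)).symm
  -- The last coordinate acts by translations. As the acting group is commutative, G(a, ·) commutes
  -- with all translations, hence is itself one.
  have htrans (a : Fin (n + 1) → A) (v : A) : G a v = G a 0 + v := by
    have := hadd (Pi.single (Fin.last n) v) a 0
    rw [add_comm, hadd, hsingle, hsingle, zero_add] at this
    exact this.symm
  refine ⟨AddMonoidHom.mk' (fun a ↦ G a 0) fun a b ↦ ?_, fun a u v ↦ ?_⟩
  · rw [hadd, htrans b, add_comm]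
  · rw [hG', htrans]
    rfl

/-- The product gives g(c) = c in the last coordinate, and degenerate simplices make the signs of
adjacent coordinates opposite, so (-1)^n g is the alternating sum. -/
lemma isBoundary_iff (hX : IsMinimal X)
    (a : Fin (n + 3) → A) :
    (∃ y : X _⦋n + 2⦌, ∀ i, t.equiv (X.δ i y) = a i) ↔
      ∑ i : Fin (n + 3), (-1 : ℤ) ^ (i : ℕ) • a i = 0 := by
  obtain ⟨g, hg⟩ := t.exists_addMonoidHom hX
  have hsingle (i : Fin (n + 1)) (c : A) :
      (-1 : ℤ) ^ n • g (Pi.single i c) = (-1 : ℤ) ^ (i : ℕ) • c := by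
    induction i using Fin.reverseInduction with
    | last =>
      have := (hg _ _ _).1 (t.isBoundary_single_last c 0)
      rw [add_zero, zero_add] at this
      rw [← this, Fin.val_last]
    | cast i ih =>
      have := (hg _ _ _).1 (t.isBoundary_degenerate i c)
      rw [map_add, add_zero, eq_comm, add_eq_zero_iff_eq_neg] at this
      rw [this, smul_neg, ih, Fin.val_succ, Fin.val_castSucc, pow_succ, mul_neg_one, neg_smul,
        neg_neg]
  have hsum (b : Fin (n + 1) → A) :
      (-1 : ℤ) ^ n • g b = ∑ i : Fin (n + 1), (-1 : ℤ) ^ (i : ℕ) • b i := by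
    conv_lhs => rw [← Finset.univ_sum_single b, map_sum, Finset.smul_sum]
    exact Finset.sum_congr rfl fun i _ ↦ hsingle i _
  have h₁ : (∃ y : X _⦋n + 2⦌, ∀ i, t.equiv (X.δ i y) = a i) ↔
      t.IsBoundary (fun i ↦ a i.castSucc.castSucc) (a (Fin.last (n + 1)).castSucc)
        (a (Fin.last (n + 2))) :=
    exists_congr fun y ↦ by
      rw [Fin.forall_fin_succ', Fin.forall_fin_succ', and_assoc]
  rw [h₁, hg, Fin.sum_univ_castSucc, Fin.sum_univ_castSucc]
  have h₂ := hsum fun i ↦ a i.castSucc.castSucc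
  simp only [Fin.val_castSucc, Fin.val_last] at h₂ ⊢
  rw [← h₂, eq_comm, ← sub_eq_zero, ← (isUnit_neg_one.pow n : IsUnit ((-1 : ℤ) ^ n)).smul_eq_zero]
  simp only [pow_succ, mul_neg_one, neg_smul, smul_sub, smul_add, neg_neg]
  rw [sub_eq_add_neg, add_right_comm]

end Kan

end GroupLabel

end Labels

/-! ### Coboundaries and chains of cocycles -/

section Coboundary

variable {A : Type u} [AddCommGroup A] {n : ℕ}

lemma sum_sum_δ {k : SimplexCategory} (f : (⦋n⦌ ⟶ k) → A) (g : ⦋n + 2⦌ ⟶ k) :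
    ∑ i : Fin (n + 3), (-1 : ℤ) ^ (i : ℕ) • ∑ j : Fin (n + 2), (-1 : ℤ) ^ (j : ℕ) •
      f (SimplexCategory.δ j ≫ SimplexCategory.δ i ≫ g) = 0 := by
  simp only [Finset.smul_sum, smul_smul, ← pow_add]
  rw [← Finset.sum_product', Finset.univ_product_univ]
  -- Terms cancel in pairs: (i, j) with j < i is matched with (j, i - 1), and otherwise with (j + 1,
  -- i).
  refine Finset.sum_involution (fun p _ ↦ if h : p.2.castSucc < p.1 then
      (p.2.castSucc, p.1.pred (Fin.ne_zero_of_lt h)) else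
      (p.2.succ, p.1.castPred (ne_of_lt ((not_lt.1 h).trans_lt (Fin.castSucc_lt_last p.2)))))
    ?_ ?_ (by simp) ?_
  · rintro ⟨i, j⟩ -
    dsimp only
    split_ifs with h
    · obtain ⟨i, rfl⟩ := i.eq_succ_of_ne_zero (Fin.ne_zero_of_lt h)
      rw [Fin.pred_succ, reassoc_of% SimplexCategory.δ_comp_δ (Fin.castSucc_lt_succ_iff.1 h)]
      simp only [Fin.val_succ, Fin.val_castSucc]
      rw [add_right_comm (i : ℕ), pow_succ, add_comm (i : ℕ), mul_neg_one, neg_smul, neg_add_cancel]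
    · rw [not_lt] at h
      obtain ⟨i, rfl⟩ := i.eq_castSucc_of_ne_last
        (ne_of_lt (h.trans_lt (Fin.castSucc_lt_last j)))
      rw [Fin.castPred_castSucc, ← reassoc_of% SimplexCategory.δ_comp_δ (Fin.castSucc_le_castSucc_iff.1 h)]
      simp only [Fin.val_succ, Fin.val_castSucc]
      rw [add_right_comm (j : ℕ), pow_succ, add_comm (i : ℕ) (j : ℕ), mul_neg_one, neg_smul, add_neg_cancel]
  · rintro ⟨i, j⟩ - - h
    dsimp only at h
    split_ifs at h with h' <;> simp only [Prod.mk.injEq] at h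
    · exact h'.ne h.1
    · exact h' (by rw [← h.1]; exact Fin.castSucc_lt_succ)
  · rintro ⟨i, j⟩ -
    by_cases h : j.castSucc < i
    · obtain ⟨i, rfl⟩ := i.eq_succ_of_ne_zero (Fin.ne_zero_of_lt h)
      have := Fin.castSucc_lt_succ_iff.1 h
      simp [h, this.not_gt]
    · obtain ⟨i, rfl⟩ := i.eq_castSucc_of_ne_last
        (ne_of_lt ((not_lt.1 h).trans_lt (Fin.castSucc_lt_last j)))
      have : i ≤ j := by simpa using h
      simp [h, this]

/-- The coboundary of a normalized cochain. -/
def coboundary {k : SimplexCategory} (f : (⦋n⦌ ⟶ k) → A)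
    (hf : ∀ e : ⦋n⦌ ⟶ k, ¬ Function.Injective e.toOrderHom → f e = 0) :
    Labelling A (n + 1) k :=
  .mk (fun g ↦ ∑ i : Fin (n + 2), (-1 : ℤ) ^ (i : ℕ) • f (SimplexCategory.δ i ≫ g))
    (sum_eq_zero_of_not_injective f hf) (sum_sum_δ f)

lemma val_coboundary {k : SimplexCategory} (f : (⦋n⦌ ⟶ k) → A) (hf) (g : ⦋n + 1⦌ ⟶ k) :
    (coboundary f hf).val g =
      ∑ i : Fin (n + 2), (-1 : ℤ) ^ (i : ℕ) • f (SimplexCategory.δ i ≫ g) := rfl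

/-- Add an initial vertex to a simplex of the standard simplex. -/
def cone {k : ℕ} (e : ⦋n⦌ ⟶ ⦋k⦌) : ⦋n + 1⦌ ⟶ ⦋k⦌ :=
  SimplexCategory.Hom.mk ⟨Fin.cons 0 e.toOrderHom, Fin.monotone_iff_le_succ.2 fun i ↦ by
    cases i using Fin.cases with
    | zero => simp
    | succ i =>
      rw [← Fin.succ_castSucc, Fin.cons_succ, Fin.cons_succ]
      exact e.toOrderHom.monotone (Fin.castSucc_lt_succ).le⟩

lemma cone_zero {k : ℕ} (e : ⦋n⦌ ⟶ ⦋k⦌) : (cone e).toOrderHom 0 = 0 := rfl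

lemma cone_succ {k : ℕ} (e : ⦋n⦌ ⟶ ⦋k⦌) (i : Fin (n + 1)) :
    (cone e).toOrderHom i.succ = e.toOrderHom i := rfl

lemma δ_zero_comp_cone {k : ℕ} (e : ⦋n⦌ ⟶ ⦋k⦌) : SimplexCategory.δ 0 ≫ cone e = e := by
  ext i : 3
  rfl

lemma δ_succ_comp_cone {k : ℕ} (e : ⦋n + 1⦌ ⟶ ⦋k⦌) (i : Fin (n + 2)) :
    SimplexCategory.δ i.succ ≫ cone e = cone (SimplexCategory.δ i ≫ e) := by
  ext j : 3
  change (cone e).toOrderHom (i.succ.succAbove j) = _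
  cases j using Fin.cases with
  | zero => rw [Fin.succ_succAbove_zero, cone_zero, cone_zero]
  | succ j => rw [Fin.succ_succAbove_succ, cone_succ, cone_succ]; rfl

/-- The cocycle condition on the cone over `e`: contracting Δ^k to its vertex 0 exhibits `a` as a
coboundary. -/
lemma val_eq_sum_cone {k : ℕ} (a : Labelling A (n + 1) ⦋k⦌) (e : ⦋n + 1⦌ ⟶ ⦋k⦌) :
    a.val e = ∑ i : Fin (n + 2), (-1 : ℤ) ^ (i : ℕ) • a.val (cone (SimplexCategory.δ i ≫ e)) := by
  have := a.sum_val (cone e)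
  rw [Fin.sum_univ_succ, δ_zero_comp_cone] at this
  simpa [δ_succ_comp_cone, pow_succ, add_neg_eq_zero] using this

/-- Any normalized cocycle on a standard simplex is connected to zero by a chain of cocycles
on simplices of one dimension more. -/
lemma exists_chain {k : ℕ} (a : Labelling A (n + 1) ⦋k⦌) :
    ∃ (N : ℕ) (W : ℕ → Labelling A (n + 1) ⦋k⦌) (F : ℕ → Labelling A (n + 1) ⦋k + 1⦌),
      W 0 = 0 ∧ W N = a ∧ ∀ m,
        (F m).pullback (SimplexCategory.δ (Fin.last (k + 1))) = W m ∧
        (F m).pullback (SimplexCategory.δ 0) = W (m + 1) := by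
  classical
  -- A cochain on the infinite simplex with vertex set ℕ: on the vertices k + 1, …, 2k + 1 it is the
  -- primitive of `a` given by coning, and elsewhere it is 0.
  let b (s : Fin (n + 1) → ℕ) : A :=
    if h : ∃ e : ⦋n⦌ ⟶ ⦋k⦌, ∀ j, s j = k + 1 + e.toOrderHom j then a.val (cone h.choose) else 0
  have hb (s : Fin (n + 1) → ℕ) (hs : ¬ Function.Injective s) : b s = 0 := by
    by_cases h : ∃ e : ⦋n⦌ ⟶ ⦋k⦌, ∀ j, s j = k + 1 + e.toOrderHom j
    · dsimp only [b]
      rw [dif_pos h]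
      refine a.val_of_not_injective _ fun h' ↦ hs fun i j hij ↦ ?_
      rw [h.choose_spec, h.choose_spec, add_right_inj, Fin.val_inj] at hij
      exact Fin.succ_injective _ (h' hij)
    · exact dif_neg h
  have hb' (e : ⦋n⦌ ⟶ ⦋k⦌) : b (fun j ↦ k + 1 + e.toOrderHom j) = a.val (cone e) := by
    have h : ∃ e' : ⦋n⦌ ⟶ ⦋k⦌, ∀ j, k + 1 + (e.toOrderHom j : ℕ) = k + 1 + e'.toOrderHom j :=
      ⟨e, fun _ ↦ rfl⟩
    dsimp only [b]
    rw [dif_pos h]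
    congr 2
    ext j : 3
    exact Fin.ext (Nat.add_left_cancel (h.choose_spec j)).symm
  -- The coboundary of `b` restricted to the window m, …, m + l. Dropping the last or first vertex
  -- of a window of length k + 2 gives two consecutive windows of length k + 1.
  let w (m l : ℕ) : Labelling A (n + 1) ⦋l⦌ :=
    coboundary (fun e : ⦋n⦌ ⟶ ⦋l⦌ ↦ b fun j ↦ m + e.toOrderHom j) fun e he ↦ hb _ fun h ↦
      he fun i j hij ↦ h (by simp only [hij])
  refine ⟨k + 1, fun m ↦ w m k, fun m ↦ w m (k + 1), ?_, ?_, fun m ↦ ⟨?_, ?_⟩⟩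
  · refine Labelling.ext fun e ↦ ?_
    dsimp only [w]
    rw [val_coboundary, Labelling.val_zero]
    refine Finset.sum_eq_zero fun i _ ↦ ?_
    dsimp only [b]
    rw [dif_neg, smul_zero]
    rintro ⟨e', he'⟩
    have h₁ := he' 0
    have h₂ := ((SimplexCategory.δ i ≫ e).toOrderHom 0).isLt
    simp only [SimplexCategory.len_mk] at h₁ h₂
    lia
  · refine Labelling.ext fun e ↦ ?_
    dsimp only [w]
    rw [val_coboundary, val_eq_sum_cone]
    exact Finset.sum_congr rfl fun i _ ↦ by rw [← hb']
  · refine Labelling.ext fun e ↦ ?_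
    dsimp only [w]
    rw [Labelling.val_pullback, val_coboundary, val_coboundary]
    refine Finset.sum_congr rfl fun i _ ↦ ?_
    congr 2
    funext j
    change m + (((Fin.last (k + 1)).succAbove (e.toOrderHom (i.succAbove j)) : Fin (k + 2)) : ℕ) = _
    rw [Fin.succAbove_last, Fin.val_castSucc]
    rfl
  · refine Labelling.ext fun e ↦ ?_
    dsimp only [w]
    rw [Labelling.val_pullback, val_coboundary, val_coboundary]
    refine Finset.sum_congr rfl fun i _ ↦ ?_
    congr 2
    funext j
    change m + (((0 : Fin (k + 2)).succAbove (e.toOrderHom (i.succAbove j)) : Fin (k + 2)) : ℕ) =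
      m + 1 + (e.toOrderHom (i.succAbove j) : ℕ)
    rw [Fin.succAbove_zero, Fin.val_succ]
    ring

end Coboundary

/-! ### Recognition of minimal Eilenberg–Mac Lane spaces -/

section Recognition

variable {A : Type u} [AddCommGroup A] {n : ℕ} {X : SSet.{u}} {x : X _⦋0⦌} [SSet.KanComplex X]
  (L : X ⟶ cocycleSet A n) {k : ℕ}

/-- Compatibility of the horn may be checked on labels in dimension k, and above dimension n + 1 a
labelling is determined by all faces but one. -/
lemma exists_label_eq_of_horn (hk : n < k + 1)
    (hL : Function.Injective (label L : X _⦋k⦌ → Labelling A n ⦋k⦌)) (F : Labelling A n ⦋k + 2⦌)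
    (i : Fin (k + 3)) (y : Fin (k + 3) → X _⦋k + 1⦌)
    (hy : ∀ j, j ≠ i → label L (y j) = F.pullback (SimplexCategory.δ j)) :
    ∃ w : X _⦋k + 2⦌, (∀ j, j ≠ i → X.δ j w = y j) ∧ label L w = F := by
  obtain ⟨w, hw⟩ := exists_filler (i := i) (x := y) (by
    intro j l hjl hj hl
    apply hL
    rw [label_δ, label_δ, hy _ hj, hy _ hl]
    refine Labelling.ext fun e ↦ ?_
    simp only [Labelling.val_pullback, Category.assoc, SimplexCategory.δ_comp_δ hjl])
  exact ⟨w, hw, Labelling.ext_of_faces_ne hk i fun j hj ↦ by rw [← label_δ, hw j hj, hy j hj]⟩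

lemma label_surjective_succ (hk : n < k + 1)
    (hL : Function.Injective (label L : X _⦋k⦌ → Labelling A n ⦋k⦌))
    (hL' : Function.Surjective (label L : X _⦋k + 1⦌ → Labelling A n ⦋k + 1⦌)) :
    Function.Surjective (label L : X _⦋k + 2⦌ → Labelling A n ⦋k + 2⦌) := fun F ↦ by
  choose y hy using fun j ↦ hL' (F.pullback (SimplexCategory.δ j))
  obtain ⟨w, -, hw⟩ := exists_label_eq_of_horn L hk hL F 0 y fun j _ ↦ hy j
  exact ⟨w, hw⟩

omit [SSet.KanComplex X] in
lemma label_constSimplex (hn : 1 ≤ n) : label L (constSimplex x k) = 0 :=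
  Labelling.ext fun e ↦ by
    rw [← topLabel_map, Labelling.val_zero, map_constSimplex, topLabel_constSimplex L hn x]

/-- Simplices with the next label of the chain are 0-th faces of (k+2)-simplices with common middle
faces. Their last faces carry the previous label and agree by induction, so the 0-th faces are
homotopic, hence equal. -/
lemma label_injective_succ (hX : IsMinimal X) (hn : 1 ≤ n) (hk : n < k + 1)
    (hpi : Subsingleton (Pi (k + 1) X x))
    (hL : Function.Injective (label L : X _⦋k⦌ → Labelling A n ⦋k⦌))
    (hL' : Function.Surjective (label L : X _⦋k + 1⦌ → Labelling A n ⦋k + 1⦌)) :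
    Function.Injective (label L : X _⦋k + 1⦌ → Labelling A n ⦋k + 1⦌) := by
  intro y z hyz
  obtain ⟨n, rfl⟩ := Nat.exists_eq_add_one_of_ne_zero (by lia : n ≠ 0)
  obtain ⟨N, W, F, hW, hN, hF⟩ := exists_chain (label L z)
  suffices h : ∀ m, ∀ y z : X _⦋k + 1⦌, label L y = W m → label L z = W m → y = z from
    h N y z (by rw [hyz, hN]) hN.symm
  intro m
  induction m with
  | zero =>
    have : Subsingleton (X.PtSimplex (k + 1) x) := (piEquiv hX).symm.injective.subsingleton
    have key (y : X _⦋k + 1⦌) (hy : label L y = W 0) :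
        ∃ f : X.PtSimplex (k + 1) x, simplex f = y :=
      exists_simplex_eq y fun i ↦ hL (by
        rw [label_δ, hy, hW, label_constSimplex L hn]
        rfl)
    intro y z hy hz
    obtain ⟨f, rfl⟩ := key y hy
    obtain ⟨f', rfl⟩ := key z hz
    rw [Subsingleton.elim f f']
  | succ m ih =>
    intro y z hy hz
    choose c hc using fun j ↦ hL' ((F m).pullback (SimplexCategory.δ j))
    have key (y : X _⦋k + 1⦌) (hy : label L y = W (m + 1)) :
        ∃ w : X _⦋k + 2⦌, X.δ 0 w = y ∧ (∀ j, j ≠ 0 → j ≠ Fin.last (k + 2) → X.δ j w = c j) ∧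
          label L (X.δ (Fin.last (k + 2)) w) = W m := by
      obtain ⟨w, hw, hw'⟩ := exists_label_eq_of_horn L hk hL (F m) (Fin.last (k + 2))
        (Function.update c 0 y) fun j hj ↦ by
          by_cases h : j = 0
          · subst h
            rw [Function.update_self, hy, (hF m).2]
          · rw [Function.update_of_ne h, hc]
      refine ⟨w, ?_, fun j h₀ h₁ ↦ ?_, ?_⟩
      · rw [hw 0 (by simp [Fin.ext_iff]), Function.update_self]
      · rw [hw j h₁, Function.update_of_ne h₀]
      · rw [label_δ, hw', (hF m).1]
    obtain ⟨w, rfl, hw, hw'⟩ := key y hy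
    obtain ⟨v, rfl, hv, hv'⟩ := key z hz
    refine hX _ _ _ (homotopic_of_δ_eq 0 fun j hj ↦ ?_)
    by_cases h : j = Fin.last (k + 2)
    · subst h
      exact ih _ _ hw' hv'
    · rw [hw j hj h, hv j hj h]

/-- A minimal Eilenberg-Mac Lane space is isomorphic to the simplicial set of cocycles. -/
lemma exists_isIso (hn : 1 ≤ n) (hX : IsMinimal X) (h : IsEilenbergMacLaneSpace A n X x) :
    ∃ L : X ⟶ cocycleSet A n, IsIso L := by
  obtain ⟨n, rfl⟩ := Nat.exists_eq_add_one_of_ne_zero (by lia : n ≠ 0)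
  have hpi (k : ℕ) (hk : k ≠ n + 1) : Subsingleton (Pi k X x) :=
    (h.trivial k hk).elim fun _ ↦ inferInstance
  have hlow := subsingleton_of_isMinimal (n := n + 1) (x := x) hX fun k hk ↦ hpi k hk.ne
  have := hlow n (Nat.lt_succ_self n)
  obtain ⟨t⟩ := nonempty_groupLabel hX h
  obtain ⟨L, hL⟩ := exists_hom t.equiv
    (fun y hy ↦ by rw [GroupLabel.constSimplex_of_mem_degenerate (x := x) y hy,
      t.equiv_constSimplex])
    (fun y ↦ (t.isBoundary_iff hX _).1 ⟨y, fun _ ↦ rfl⟩)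
  have htop : Function.Bijective (topLabel L) := by
    rw [show topLabel L = t.equiv from funext hL]
    exact t.equiv.bijective
  have h₀ : Function.Bijective (label L : X _⦋n + 1⦌ → Labelling A (n + 1) ⦋n + 1⦌) :=
    ⟨fun y z hyz ↦ htop.1 (congrArg (fun f ↦ f.val (𝟙 _)) hyz), fun f ↦ by
      obtain ⟨y, hy⟩ := htop.2 (f.val (𝟙 _))
      exact ⟨y, Labelling.ext_id hy⟩⟩
  have h₁ : Function.Surjective (label L : X _⦋n + 2⦌ → Labelling A (n + 1) ⦋n + 2⦌) := fun f ↦ by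
    obtain ⟨y, hy⟩ := (t.isBoundary_iff hX fun i ↦ f.val (SimplexCategory.δ i)).2 (by
      simpa using f.sum_val (𝟙 _))
    refine ⟨y, Labelling.ext_of_faces le_rfl fun i ↦ Labelling.ext_id ?_⟩
    rw [← label_δ, Labelling.val_pullback, Category.id_comp, ← hy, ← hL]
    rfl
  -- Injectivity in a dimension needs surjectivity there, so surjectivity is carried one dimension
  -- ahead.
  have h₂ (m : ℕ) : Function.Bijective
        (label L : X _⦋n + 1 + m⦌ → Labelling A (n + 1) ⦋n + 1 + m⦌) ∧
      Function.Surjective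
        (label L : X _⦋n + 1 + m + 1⦌ → Labelling A (n + 1) ⦋n + 1 + m + 1⦌) := by
    induction m with
    | zero => exact ⟨h₀, h₁⟩
    | succ m ih =>
      have h₃ := label_injective_succ (x := x) L hX hn (by lia) (hpi _ (by lia)) ih.1.1 ih.2
      exact ⟨⟨h₃, ih.2⟩, label_surjective_succ L (by lia) ih.1.1 ih.2⟩
  refine ⟨L, ?_⟩
  have (k : SimplexCategoryᵒᵖ) : IsIso (L.app k) := by
    obtain ⟨⟨k⟩⟩ := k
    rw [isIso_iff_bijective]
    change Function.Bijective (label L : X _⦋k⦌ → Labelling A (n + 1) ⦋k⦌)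
    obtain hk | hk := lt_or_ge k (n + 1)
    · have := hlow k hk
      exact ⟨fun _ _ _ ↦ Subsingleton.elim _ _, fun f ↦ ⟨constSimplex x k,
        (Labelling.eq_zero_of_lt hk _).trans (Labelling.eq_zero_of_lt hk _).symm⟩⟩
    · obtain ⟨m, rfl⟩ := Nat.exists_eq_add_of_le hk
      exact (h₂ m).1
  exact NatIso.isIso_of_isIso_app L

end Recognition

end EilenbergMacLane

theorem mainTheorem8 (A : Type u) [AddCommGroup A] (n : ℕ) (hn : 1 ≤ n) :
    EilenbergMacLane.HasStandardLowSimplices A n (EilenbergMacLane.H A n) ∧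
    EilenbergMacLane.IsCanonicalCompletion (EilenbergMacLane.skeleton A n)
      (EilenbergMacLane.H A n) ∧
    EilenbergMacLane.IsMinimal (EilenbergMacLane.H A n) ∧
    ∃ pt : (EilenbergMacLane.H A n) _⦋0⦌,
      EilenbergMacLane.IsEilenbergMacLaneSpace A n (EilenbergMacLane.H A n) pt ∧
      ∀ (K : SSet.{u}) (x : K _⦋0⦌),
        EilenbergMacLane.IsEilenbergMacLaneSpace A n K x → EilenbergMacLane.IsMinimal K →
        ∃ e : EilenbergMacLane.H A n ≅ K, e.hom.app (op ⦋0⦌) pt = x := by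
  let L := (EilenbergMacLane.isoCocycleSet A n).hom
  obtain ⟨pt⟩ := (EilenbergMacLane.hasStandardLowSimplices L).1 0 hn
  refine ⟨EilenbergMacLane.hasStandardLowSimplices L, EilenbergMacLane.isCanonicalCompletion L,
    EilenbergMacLane.isMinimal L, pt.default,
    EilenbergMacLane.isEilenbergMacLaneSpace L hn _, fun K x hK hK' ↦ ?_⟩
  have := hK.kan
  obtain ⟨M, hM⟩ := EilenbergMacLane.exists_isIso hn hK' hK
  -- `K` has only one vertex, so any isomorphism is pointed.
  have := EilenbergMacLane.subsingleton_of_lt M hn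
  exact ⟨asIso L ≪≫ (asIso M).symm, Subsingleton.elim _ _⟩
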